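/- For an open set $\Omega\subset\mathbb{C}^2$ let $\lambda$ be Lebesgue measure, let $A^2(\Omega)$ be the space of holomorphic functions $f$ on $\Omega$ with $\int_\Omega |f|^2\,d\lambda<\infty$, with the $L^2(\Omega)$ norm, and let $K_\Omega(\cdot,w)$, $w\in\Omega$, denote the Bergman kernel, i.e. the unique element of $A^2(\Omega)$ with $f(w)=\int_\Omega f(\zeta)\overline{K_\Omega(\zeta,w)}\,d\lambda(\zeta)$ for all $f\in A^2(\Omega)$. For $q>0$ put $$A^2(\log A)^q(\Omega)=\Big\{f \text{ holomorphic on } \Omega:\ \int_\Omega |f|^2(\log^+|f|)^q\,d\lambda<\infty\Big\},\qquad \log^+t=\max\{\log t,0\}.$$ **Theorem 1.5.** For every $s\in(0,1)$ there is a bounded domain $\Omega^{(s)}\subset\mathbb{C}^2$ with $C^\infty$ boundary which is not pseudoconvex (it has no continuous plurisubharmonic exhaustion function), such that for every real $q\ge \frac1s-1$ the following hold: 1. $A^2(\log A)^q(\Omega^{(s)})$ is not dense in $A^2(\Omega^{(s)})$; 2. $K_{\Omega^{(s)}}(\cdot,w)\notin A^2(\log A)^q(\Omega^{(s)})$ for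 some $w\in\Omega^{(s)}$. -/

import Mathlib

open MeasureTheory Set
open scoped ContDiff ComplexConjugate

/-- Open connected nonempty bounded subsets of `ℂ²` whose boundary is `C^∞`: near each boundary
point the set is `{ρ < 0}` for a smooth real function `ρ` with nonvanishing differential at that
point. -/
structure IsSmoothBoundedDomain (Ω : Set (ℂ × ℂ)) : Prop where
  isOpen : IsOpen Ω
  isConnected : IsConnected Ω
  isBounded : Bornology.IsBounded Ω
  smooth_boundary : ∀ p ∈ frontier Ω, ∃ U : Set (ℂ × ℂ), IsOpen U ∧ p ∈ U ∧
    ∃ ρ : ℂ × ℂ → ℝ, ContDiffOn ℝ ∞ ρ U ∧ fderiv ℝ ρ p ≠ 0 ∧ Ω ∩ U = {x ∈ U | ρ x < 0}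

/-- Continuous plurisubharmonic functions on `Ω`: the sub-mean value inequality holds on every
closed disc `{a + τ b : |τ| ≤ 1}` contained in a complex line and in `Ω`. -/
structure IsContinuousPSHOn (u : ℂ × ℂ → ℝ) (Ω : Set (ℂ × ℂ)) : Prop where
  continuousOn : ContinuousOn u Ω
  le_average : ∀ a b : ℂ × ℂ, (∀ τ : ℂ, ‖τ‖ ≤ 1 → a + τ • b ∈ Ω) →
    u a ≤ Real.circleAverage (fun τ : ℂ => u (a + τ • b)) 0 1

/-- An open set is pseudoconvex if it has a continuous plurisubharmonic exhaustion function `u`,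
that is, every sublevel set `{u < c}` is relatively compact in `Ω`. -/
def IsPseudoconvex (Ω : Set (ℂ × ℂ)) : Prop :=
  ∃ u : ℂ × ℂ → ℝ, IsContinuousPSHOn u Ω ∧
    ∀ c : ℝ, IsCompact (closure {z ∈ Ω | u z < c}) ∧ closure {z ∈ Ω | u z < c} ⊆ Ω

/-- The Bergman space `A²(Ω)`; functions are total, and only their values on `Ω` matter. -/
def bergmanSpace (Ω : Set (ℂ × ℂ)) : Set (ℂ × ℂ → ℂ) :=
  {f | DifferentiableOn ℂ f Ω ∧ MemLp f 2 (volume.restrict Ω)}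

/-- The space `A²(log A)^q(Ω)` of holomorphic `f` with `∫_Ω |f|² (log⁺ |f|)^q dλ < ∞`. -/
def bergmanLogSpace (q : ℝ) (Ω : Set (ℂ × ℂ)) : Set (ℂ × ℂ → ℂ) :=
  {f | DifferentiableOn ℂ f Ω ∧
    ∫⁻ ζ in Ω, ENNReal.ofReal (‖f ζ‖ ^ 2 * (Real.posLog ‖f ζ‖) ^ q) < ⊤}

/-- A set `S` of functions in `A²(Ω)` is dense in `A²(Ω)` for the `L²(Ω)` norm. -/
def IsDenseInBergmanSpace (S : Set (ℂ × ℂ → ℂ)) (Ω : Set (ℂ × ℂ)) : Prop :=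
  ∀ f ∈ bergmanSpace Ω, ∀ ε : ℝ, 0 < ε →
    ∃ g ∈ S, eLpNorm (f - g) 2 (volume.restrict Ω) < ENNReal.ofReal ε

/-- `k` is the element of `A²(Ω)` that reproduces the value at `w`; its values on an open `Ω` are
unique. -/
def IsReproducingAt (Ω : Set (ℂ × ℂ)) (w : ℂ × ℂ) (k : ℂ × ℂ → ℂ) : Prop :=
  k ∈ bergmanSpace Ω ∧ ∀ f ∈ bergmanSpace Ω, f w = ∫ ζ in Ω, f ζ * conj (k ζ)

open Classical in
/-- The Bergman kernel `K_Ω(z, w)`: the function `K_Ω(·, w)` is the element of `A²(Ω)` reproducing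
the value at `w`. It exists for every open `Ω` and `w ∈ Ω`; the default `0` is used otherwise. -/
noncomputable def bergmanKernel (Ω : Set (ℂ × ℂ)) (z w : ℂ × ℂ) : ℂ :=
  if h : ∃ k, IsReproducingAt Ω w k then h.choose z else 0

open Filter Topology
open scoped ENNReal

/-! With t = |w|² - 4 and Q = |z|², the domain is {E(t² - 1) - t Re z / 100 - Q + Q² < 0}, where E =
`profile s` is nonnegative and flat like exp(-|u|^(-s)) at its only zero u = 0. The fibre over z = 0
is empty. Over small z ≠ 0 it lies near the circles |w| = √3 and |w| = √5, and its area is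
comparable to (log 1/|z|)^(-1/s). Hence the integral of |1/z|² behaves like ∫ dr / (r
log(1/r)^(1/s)), which is finite because s < 1. The extra factor log^q turns it into ∫ dr / (r
log(1/r)^(1/s - q)), which diverges exactly when q ≥ 1/s - 1.

A bounded functional detects 1/z. Average f(z, ·) over |w| = √5 if Re z ≥ 0 and over |w| = √3
otherwise. For |z| near 7/10 the fibre contains the whole annulus between these circles, so the two
averages agree there. The identity theorem carries the agreement down to 0 along both halves of the
imaginary axis (`fiberMean_sqrt_five_eq`). The average is therefore holomorphic in a punctured disc.
Its residue at 0 is bounded on A² (`exists_enorm_fiberResidue_le`), equals 1 on 1/z, and vanishes on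
A²(log A)^q (`fiberResidue_eq_zero`), so this space is not dense. By Riesz the residue is f ↦ ⟨f, k⟩
with k ≠ 0, and k(w) is the conjugate of the residue of K(·, w). So some K(·, w) has a nonzero
residue and lies outside A²(log A)^q (`exists_bergmanKernel_ne_zero`).

The term t Re z keeps the boundary smooth at the two circles over z = 0, and a family of analytic
discs touching the boundary from inside excludes pseudoconvexity. -/

/-! ### The flat function and the profile. -/

/-- The function `u ↦ u^(-p) exp(-u^(-s))` on `(0, ∞)`, extended by zero. -/
noncomputable def flatPow (s p u : ℝ) : ℝ :=
  if 0 < u then u ^ (-p) * Real.exp (-(u ^ (-s))) else 0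

lemma flatPow_of_pos {s p u : ℝ} (hu : 0 < u) :
    flatPow s p u = u ^ (-p) * Real.exp (-(u ^ (-s))) := if_pos hu

lemma flatPow_of_nonpos {s p u : ℝ} (hu : u ≤ 0) : flatPow s p u = 0 := if_neg hu.not_gt

lemma flatPow_nonneg (s p u : ℝ) : 0 ≤ flatPow s p u := by
  unfold flatPow; split_ifs <;> positivity

lemma tendsto_flatPow_zero {s : ℝ} (hs : 0 < s) (p : ℝ) :
    Tendsto (flatPow s p) (𝓝 0) (𝓝 0) := by
  have h1 : Tendsto (flatPow s p) (𝓝[>] 0) (𝓝 0) := by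
    have h := (tendsto_rpow_mul_exp_neg_mul_atTop_nhds_zero (p / s) 1 one_pos).comp
      (tendsto_rpow_neg_nhdsGT_zero (y := -s) (by linarith))
    refine h.congr' ?_
    filter_upwards [self_mem_nhdsWithin] with u (hu : 0 < u)
    rw [flatPow_of_pos hu]
    simp only [Function.comp]
    rw [← Real.rpow_mul hu.le]
    congr 2
    · field_simp
    · ring
  have h2 : Tendsto (flatPow s p) (𝓝[≤] 0) (𝓝 0) :=
    tendsto_const_nhds.congr' (by
      filter_upwards [self_mem_nhdsWithin] with u hu using (flatPow_of_nonpos hu).symm)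
  have h := h2.sup h1
  rwa [nhdsLE_sup_nhdsGT] at h

/-- The family `flatPow s p`, with p free, is closed under differentiation up to linear
combinations. This is what lets smoothness be proved by induction on the order for all p at once. -/
lemma hasDerivAt_flatPow {s : ℝ} (hs : 0 < s) (p u : ℝ) :
    HasDerivAt (flatPow s p) (-p * flatPow s (p + 1) u + s * flatPow s (p + s + 1) u) u := by
  rcases lt_trichotomy u 0 with hu | rfl | hu
  · rw [flatPow_of_nonpos hu.le, flatPow_of_nonpos hu.le]
    simp only [mul_zero, add_zero]
    refine (hasDerivAt_const u (0 : ℝ)).congr_of_eventuallyEq ?_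
    filter_upwards [Iio_mem_nhds hu] with v hv using flatPow_of_nonpos (le_of_lt hv)
  · rw [flatPow_of_nonpos le_rfl, flatPow_of_nonpos le_rfl]
    simp only [mul_zero, add_zero]
    rw [hasDerivAt_iff_tendsto_slope]
    refine ((tendsto_flatPow_zero hs (p + 1)).mono_left nhdsWithin_le_nhds).congr' ?_
    filter_upwards [self_mem_nhdsWithin] with v hv
    rw [slope_def_field, flatPow_of_nonpos (le_refl (0 : ℝ)), sub_zero, sub_zero]
    rcases le_or_gt v 0 with h | h
    · simp [flatPow_of_nonpos h]
    · rw [flatPow_of_pos h, flatPow_of_pos h, neg_add, Real.rpow_add h, Real.rpow_neg_one]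
      field_simp
  · have h1 := (Real.hasDerivAt_rpow_const (p := -p) (Or.inl hu.ne')).mul
      (Real.hasDerivAt_rpow_const (p := -s) (Or.inl hu.ne')).neg.exp
    have h2 : HasDerivAt (flatPow s p) _ u := h1.congr_of_eventuallyEq (by
      filter_upwards [Ioi_mem_nhds hu] with v hv using flatPow_of_pos hv)
    convert h2 using 1
    rw [flatPow_of_pos hu, flatPow_of_pos hu]
    have e1 : u ^ (-(p + 1)) = u ^ (-p - 1) := by ring_nf
    have e2 : u ^ (-(p + s + 1)) = u ^ (-p) * u ^ (-s - 1) := by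
      rw [← Real.rpow_add hu]; ring_nf
    rw [e1, e2]; simp only [Pi.neg_apply]; ring

lemma contDiff_flatPow {s : ℝ} (hs : 0 < s) (p : ℝ) : ContDiff ℝ ∞ (flatPow s p) := by
  rw [contDiff_infty]
  intro n
  induction n generalizing p with
  | zero =>
    exact contDiff_zero.2 (continuous_iff_continuousAt.2 fun u =>
      (hasDerivAt_flatPow hs p u).continuousAt)
  | succ n ih =>
    push_cast
    rw [contDiff_succ_iff_deriv]
    refine ⟨fun u => (hasDerivAt_flatPow hs p u).differentiableAt, by simp, ?_⟩
    have : deriv (flatPow s p) =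
        fun u => -p * flatPow s (p + 1) u + s * flatPow s (p + s + 1) u :=
      funext fun u => (hasDerivAt_flatPow hs p u).deriv
    rw [this]
    exact (contDiff_const.mul (ih _)).add (contDiff_const.mul (ih _))

lemma flatPow_zero_of_pos {s u : ℝ} (hu : 0 < u) :
    flatPow s 0 u = Real.exp (-(u ^ (-s))) := by
  rw [flatPow_of_pos hu]; simp

lemma monotone_flatPow_zero {s : ℝ} (hs : 0 < s) : Monotone (flatPow s 0) := by
  refine monotone_of_deriv_nonneg (fun u => (hasDerivAt_flatPow hs 0 u).differentiableAt)
    fun u => ?_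
  rw [(hasDerivAt_flatPow hs 0 u).deriv]
  have := flatPow_nonneg s (0 + s + 1) u
  simp only [neg_zero, zero_mul, zero_add] at this ⊢
  positivity

/-- A smooth function that vanishes exactly at the origin, to the order of `exp(-|u|^(-s))`, and
grows exponentially. -/
noncomputable def profile (s u : ℝ) : ℝ :=
  -- The constant gives the value 3/16 at u = -1, which is Q - Q² at Q = 1/4. The factor exp u on u
  -- > 0 makes the profile at most its own derivative there.
  3 / 16 * Real.exp 1 * (flatPow s 0 (-u) + Real.exp u * flatPow s 0 u)

lemma contDiff_profile {s : ℝ} (hs : 0 < s) : ContDiff ℝ ∞ (profile s) := by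
  unfold profile
  exact contDiff_const.mul (((contDiff_flatPow hs 0).comp contDiff_neg).add
    (Real.contDiff_exp.mul (contDiff_flatPow hs 0)))

lemma profile_nonneg (s u : ℝ) : 0 ≤ profile s u := by
  have := flatPow_nonneg s 0 u
  have := flatPow_nonneg s 0 (-u)
  unfold profile; positivity

lemma profile_of_nonpos {s u : ℝ} (hu : u ≤ 0) :
    profile s u = 3 / 16 * Real.exp 1 * flatPow s 0 (-u) := by
  simp [profile, flatPow_of_nonpos hu]

lemma profile_of_nonneg {s u : ℝ} (hu : 0 ≤ u) :
    profile s u = 3 / 16 * Real.exp 1 * (Real.exp u * flatPow s 0 u) := by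
  simp [profile, flatPow_of_nonpos (neg_nonpos.2 hu)]

lemma profile_zero (s : ℝ) : profile s 0 = 0 := by
  rw [profile_of_nonneg le_rfl, flatPow_of_nonpos le_rfl]; simp

lemma profile_anti {s u v : ℝ} (hs : 0 < s) (huv : u ≤ v) (hv : v ≤ 0) :
    profile s v ≤ profile s u := by
  rw [profile_of_nonpos hv, profile_of_nonpos (huv.trans hv)]
  have := monotone_flatPow_zero hs (neg_le_neg huv)
  gcongr

lemma profile_neg_one (s : ℝ) : profile s (-1) = 3 / 16 := by
  rw [profile_of_nonpos (by norm_num), flatPow_zero_of_pos (by norm_num)]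
  simp [mul_assoc, ← Real.exp_add]

lemma profile_le_of_mem {s u : ℝ} (hs : 0 < s) (h1 : -1 ≤ u) (h0 : u ≤ 0) :
    profile s u ≤ 3 / 16 := profile_neg_one s ▸ profile_anti hs h1 h0

lemma exp_le_profile {s u : ℝ} (hs : 0 < s) (hu : 1 ≤ u) :
    3 / 16 * Real.exp u ≤ profile s u := by
  rw [profile_of_nonneg (by linarith)]
  have h := monotone_flatPow_zero hs hu
  rw [flatPow_zero_of_pos one_pos] at h
  simp only [Real.one_rpow] at h
  have : 3 / 16 * Real.exp u = 3 / 16 * Real.exp 1 * (Real.exp u * Real.exp (-1)) := by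
    rw [← Real.exp_add, mul_assoc, ← Real.exp_add]; ring_nf
  rw [this]
  gcongr

lemma profile_le_deriv {s u : ℝ} (hs : 0 < s) (hu : 0 < u) : profile s u ≤ deriv (profile s) u := by
  have h : HasDerivAt (profile s) (profile s u + 3 / 16 * Real.exp 1 *
      (Real.exp u * (s * flatPow s (s + 1) u))) u := by
    have h1 := ((Real.hasDerivAt_exp u).mul (hasDerivAt_flatPow hs 0 u)).const_mul
      (3 / 16 * Real.exp 1)
    refine (h1.congr_of_eventuallyEq ?_).congr_deriv ?_
    · filter_upwards [Ioi_mem_nhds hu] with v hv using profile_of_nonneg (le_of_lt hv)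
    · rw [profile_of_nonneg hu.le]; simp only [neg_zero, zero_mul, zero_add]; ring
  rw [h.deriv]
  have := flatPow_nonneg s (s + 1) u
  have : 0 ≤ 3 / 16 * Real.exp 1 * (Real.exp u * (s * flatPow s (s + 1) u)) := by positivity
  linarith

lemma le_profile {s u : ℝ} (hu : u ≠ 0) :
    1 / 2 * Real.exp (-(|u| ^ (-s))) ≤ profile s u := by
  have he : 1 / 2 ≤ 3 / 16 * Real.exp 1 := by linarith [Real.exp_one_gt_d9]
  rcases hu.lt_or_gt with h | h
  · rw [profile_of_nonpos h.le, flatPow_zero_of_pos (by linarith), abs_of_neg h]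
    gcongr
  · rw [profile_of_nonneg h.le, flatPow_zero_of_pos h, abs_of_pos h]
    have : 1 ≤ Real.exp u := Real.one_le_exp h.le
    have h2 := Real.exp_pos (-(u ^ (-s)))
    calc _ ≤ 3 / 16 * Real.exp 1 * Real.exp (-(u ^ (-s))) := by gcongr
      _ ≤ _ := by gcongr; nlinarith

lemma profile_le {s u : ℝ} (hu : |u| ≤ 1) (h0 : u ≠ 0) :
    profile s u ≤ 2 * Real.exp (-(|u| ^ (-s))) := by
  have he : Real.exp 1 < 2.7182818286 := Real.exp_one_lt_d9
  rcases h0.lt_or_gt with h | h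
  · rw [profile_of_nonpos h.le, flatPow_zero_of_pos (by linarith), abs_of_neg h]
    gcongr; linarith
  · rw [profile_of_nonneg h.le, flatPow_zero_of_pos h, abs_of_pos h]
    have h1 : Real.exp u ≤ Real.exp 1 := Real.exp_le_exp.2 ((le_abs_self u).trans hu)
    have h2 : 3 / 16 * Real.exp 1 * Real.exp u ≤ 2 := by
      nlinarith [Real.exp_pos 1, Real.exp_pos u]
    rw [← mul_assoc]
    gcongr

/-! ### The domain: boundedness and smooth boundary. -/

/-- The defining function of the domain `pinchedDomain s`. -/
noncomputable def pinchedDefFun (s : ℝ) (p : ℂ × ℂ) : ℝ :=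
  -- Where z = 0 and |w|² is 3 or 5 all other terms are stationary. The term linear in Re z keeps
  -- the gradient nonzero there.
  profile s ((Complex.normSq p.2 - 4) ^ 2 - 1) - 1 / 100 * (Complex.normSq p.2 - 4) * p.1.re
    - Complex.normSq p.1 + Complex.normSq p.1 ^ 2

/-- A smooth bounded Hartogs domain whose fibres over the first coordinate `z` are nonempty in a
punctured neighbourhood of `0` and shrink to two circles as `z → 0`. -/
def pinchedDomain (s : ℝ) : Set (ℂ × ℂ) := {p | pinchedDefFun s p < 0}

lemma contDiff_complex_normSq : ContDiff ℝ ∞ Complex.normSq := by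
  have : (Complex.normSq : ℂ → ℝ) = fun z => ‖z‖ ^ 2 := funext Complex.normSq_eq_norm_sq
  rw [this]; exact contDiff_norm_sq ℝ

lemma contDiff_pinchedDefFun {s : ℝ} (hs : 0 < s) : ContDiff ℝ ∞ (pinchedDefFun s) := by
  have h1 : ContDiff ℝ ∞ fun p : ℂ × ℂ => Complex.normSq p.1 :=
    contDiff_complex_normSq.comp contDiff_fst
  have h2 : ContDiff ℝ ∞ fun p : ℂ × ℂ => Complex.normSq p.2 :=
    contDiff_complex_normSq.comp contDiff_snd
  have h3 : ContDiff ℝ ∞ fun p : ℂ × ℂ => p.1.re := Complex.reCLM.contDiff.comp contDiff_fst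
  have h4 : ContDiff ℝ ∞ fun p : ℂ × ℂ => profile s ((Complex.normSq p.2 - 4) ^ 2 - 1) :=
    (contDiff_profile hs).comp (((h2.sub contDiff_const).pow 2).sub contDiff_const)
  exact (((h4.sub ((contDiff_const.mul (h2.sub contDiff_const)).mul h3)).sub h1).add (h1.pow 2))

lemma isOpen_pinchedDomain {s : ℝ} (hs : 0 < s) : IsOpen (pinchedDomain s) :=
  isOpen_lt (contDiff_pinchedDefFun hs).continuous continuous_const

lemma re_sq_le_normSq (z : ℂ) : z.re ^ 2 ≤ Complex.normSq z := by
  rw [Complex.normSq_apply]; nlinarith [sq_nonneg z.im]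

/-- For t² ≥ 4 the exponential growth of the profile beats the mixed term and Q - Q² ≤ 1/4. Once t
is bounded, the term Q² confines z. -/
lemma bounds_of_pinchedDefFun_nonpos {s : ℝ} (hs : 0 < s) {p : ℂ × ℂ} (hp : pinchedDefFun s p ≤ 0) :
    (Complex.normSq p.2 - 4) ^ 2 < 4 ∧ Complex.normSq p.1 < 103 / 100 := by
  have hx := re_sq_le_normSq p.1
  have hQ := Complex.normSq_nonneg p.1
  have hE := profile_nonneg s ((Complex.normSq p.2 - 4) ^ 2 - 1)
  unfold pinchedDefFun at hp
  set t := Complex.normSq p.2 - 4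
  set Q := Complex.normSq p.1
  set x := p.1.re
  have htx : t * x ≤ (t ^ 2 + Q) / 2 := by nlinarith [sq_nonneg (t - x)]
  have h1 : t ^ 2 < 4 := by
    by_contra! h
    have h3 := exp_le_profile hs (u := t ^ 2 - 1) (by linarith)
    have h4 := Real.quadratic_le_exp_of_nonneg (x := t ^ 2 - 1) (by linarith)
    nlinarith [sq_nonneg (Q - 1 / 2), mul_nonneg (sub_nonneg.2 h) (sub_nonneg.2 h)]
  refine ⟨h1, ?_⟩
  by_contra! h
  nlinarith

lemma isBounded_pinchedDomain {s : ℝ} (hs : 0 < s) : Bornology.IsBounded (pinchedDomain s) := by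
  refine (Metric.isBounded_closedBall (x := (0 : ℂ × ℂ)) (r := 3)).subset fun p hp => ?_
  obtain ⟨h1, h2⟩ := bounds_of_pinchedDefFun_nonpos hs (le_of_lt hp)
  rw [mem_closedBall_zero_iff, Prod.norm_def]
  rw [Complex.normSq_eq_norm_sq] at h1 h2
  refine max_le ?_ ?_
  · nlinarith [norm_nonneg p.1]
  · have : ‖p.2‖ ^ 2 < 6 := by nlinarith
    nlinarith [norm_nonneg p.2]

/-- The z-equations with ρ = 0 force either Q = 0, excluded since then t = 0 and E = 3/16, or Q near
1/2. In the latter case E exceeds 3/16, so t² > 1, where the profile is too steep for the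
w-equation. -/
lemma no_critical_point {s : ℝ} (hs : 0 < s) {t x y : ℝ} (ht4 : t ^ 2 < 4)
    (hρ : profile s (t ^ 2 - 1) - 1 / 100 * t * x - (x ^ 2 + y ^ 2) + (x ^ 2 + y ^ 2) ^ 2 = 0)
    (hx : -(1 / 100) * t - 2 * x + 4 * (x ^ 2 + y ^ 2) * x = 0)
    (hy : y * (4 * (x ^ 2 + y ^ 2) - 2) = 0)
    (hw' : 2 * t * deriv (profile s) (t ^ 2 - 1) = 1 / 100 * x) : False := by
  set Q := x ^ 2 + y ^ 2 with hQ
  set E := profile s (t ^ 2 - 1) with hE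
  have hE0 : 0 ≤ E := profile_nonneg _ _
  have hQ0 : 0 ≤ Q := by positivity
  have hkt : 1 / 100 * t = (4 * Q - 2) * x := by linarith
  have hEQ : E = 3 * Q ^ 2 - Q := by
    have h3 : (4 * Q - 2) * Q = (4 * Q - 2) * x ^ 2 := by
      rw [hQ] at hy ⊢; linear_combination y * hy
    have h4 : 1 / 100 * t * x = (4 * Q - 2) * Q := by rw [hkt, h3]; ring
    linarith
  have hQpos : Q ≠ 0 := by
    intro h
    have hx0 : x = 0 := by nlinarith [sq_nonneg x, sq_nonneg y]
    have ht0 : t = 0 := by rw [hx0] at hkt; linarith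
    have : E = 3 / 16 := by rw [hE, ht0, ← profile_neg_one s]; norm_num
    rw [h] at hEQ; linarith
  have hQ3 : 1 / 3 ≤ Q := by
    have : 0 < Q := lt_of_le_of_ne hQ0 (Ne.symm hQpos)
    by_contra! h
    nlinarith
  have hsq : (4 * Q - 2) ^ 2 * Q = (1 / 100) ^ 2 * t ^ 2 := by
    have h3 : (4 * Q - 2) ^ 2 * Q = (4 * Q - 2) ^ 2 * x ^ 2 := by
      rw [hQ] at hy ⊢; linear_combination y * (4 * (x ^ 2 + y ^ 2) - 2) * hy
    rw [h3]; linear_combination (-(4 * Q - 2) * x - 1 / 100 * t) * hkt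
  -- From `hsq` with t² < 4 and Q ≥ 1/3. Then Q is within 1/100 of 1/2, and E = 3Q² - Q is close to
  -- 1/4.
  have hnear : (4 * Q - 2) ^ 2 ≤ (4 / 100) ^ 2 := by nlinarith [sq_nonneg (4 * Q - 2)]
  obtain ⟨hQl, hQu⟩ := abs_le.1 (abs_le_of_sq_le_sq hnear (by norm_num))
  have hEl : 1 / 5 < E := by rw [hEQ]; nlinarith
  have hu : 0 < t ^ 2 - 1 := by
    by_contra! h
    have := profile_le_of_mem hs (u := t ^ 2 - 1) (by nlinarith [sq_nonneg t]) h
    linarith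
  have hder := profile_le_deriv hs hu
  have hxQ : x ^ 2 ≤ Q := by rw [hQ]; nlinarith [sq_nonneg y]
  clear_value E Q
  generalize deriv (profile s) (t ^ 2 - 1) = D at *
  have h5 : 4 * (t ^ 2 * D ^ 2) = 1 / 10000 * x ^ 2 := by
    linear_combination (2 * t * D + 1 / 100 * x) * hw'
  have hD : (1 / 5) ^ 2 ≤ D ^ 2 := pow_le_pow_left₀ (by norm_num) (by linarith) 2
  have h6 : D ^ 2 ≤ t ^ 2 * D ^ 2 := le_mul_of_one_le_left (sq_nonneg D) (by linarith)
  have h7 : x ^ 2 ≤ 1 := by linarith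
  linarith

lemma fderiv_pinchedDefFun_ne_zero {s : ℝ} (hs : 0 < s) {p : ℂ × ℂ} (hp : pinchedDefFun s p = 0) :
    fderiv ℝ (pinchedDefFun s) p ≠ 0 := by
  intro h0
  obtain ⟨ht4, -⟩ := bounds_of_pinchedDefFun_nonpos hs hp.le
  have hd : HasFDerivAt (pinchedDefFun s) (0 : ℂ × ℂ →L[ℝ] ℝ) p := by
    rw [← h0]
    exact ((contDiff_pinchedDefFun hs).differentiable (by simp) p).hasFDerivAt
  have line : ∀ v : ℂ × ℂ, HasDerivAt (fun e : ℝ => pinchedDefFun s (p + e • v)) 0 0 := by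
    intro v
    have hl : HasDerivAt (fun e : ℝ => p + e • v) ((1 : ℝ) • v) 0 :=
      ((hasDerivAt_id (0 : ℝ)).smul_const v).const_add p
    have := HasFDerivAt.comp_hasDerivAt_of_eq (0 : ℝ) hd hl (by simp)
    simpa [Function.comp_def] using this
  obtain ⟨⟨x, y⟩, w⟩ := p
  set m := Complex.normSq w with hm
  set t := m - 4 with ht
  set Q := x ^ 2 + y ^ 2 with hQ
  set E := profile s (t ^ 2 - 1) with hE
  have hρ : E - 1 / 100 * t * x - Q + Q ^ 2 = 0 := by
    rw [← hp]; simp only [pinchedDefFun, Complex.normSq_mk]; rw [← hm, ← ht, ← hE, hQ]; ring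
  have hx : -(1 / 100) * t - 2 * x + 4 * Q * x = 0 := by
    have h1 := line (1, 0)
    have h2 : HasDerivAt (fun e : ℝ => E - 1 / 100 * t * (x + e) - ((x + e) ^ 2 + y ^ 2)
        + ((x + e) ^ 2 + y ^ 2) ^ 2) (-(1 / 100) * t - 2 * x + 4 * Q * x) 0 := by
      have ha : HasDerivAt (fun e : ℝ => x + e) 1 0 := (hasDerivAt_id (0 : ℝ)).const_add x
      have hb := (ha.pow 2).add_const (y ^ 2)
      refine ((((ha.const_mul (1 / 100 * t)).const_sub E).sub hb).add (hb.pow 2)).congr_deriv ?_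
      simp [hQ]; ring
    refine h2.unique (h1.congr_of_eventuallyEq (Eventually.of_forall fun e => ?_))
    have : ((⟨x, y⟩ : ℂ), w) + e • ((1 : ℂ), (0 : ℂ)) = (⟨x + e, y⟩, w) :=
      Prod.ext (Complex.ext (by simp) (by simp)) (by simp)
    beta_reduce; rw [this]; simp only [pinchedDefFun, Complex.normSq_mk, ← hm, ← ht, ← hE]; ring
  have hy : y * (4 * Q - 2) = 0 := by
    have h1 := line (Complex.I, 0)
    have h2 : HasDerivAt (fun e : ℝ => E - 1 / 100 * t * x - (x ^ 2 + (y + e) ^ 2)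
        + (x ^ 2 + (y + e) ^ 2) ^ 2) (y * (4 * Q - 2)) 0 := by
      have ha : HasDerivAt (fun e : ℝ => y + e) 1 0 := (hasDerivAt_id (0 : ℝ)).const_add y
      have hb := (ha.pow 2).const_add (x ^ 2)
      refine ((hb.const_sub (E - 1 / 100 * t * x)).add (hb.pow 2)).congr_deriv ?_
      simp [hQ]; ring
    refine h2.unique (h1.congr_of_eventuallyEq (Eventually.of_forall fun e => ?_))
    have : ((⟨x, y⟩ : ℂ), w) + e • (Complex.I, (0 : ℂ)) = (⟨x, y + e⟩, w) :=
      Prod.ext (Complex.ext (by simp) (by simp)) (by simp)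
    beta_reduce; rw [this]; simp only [pinchedDefFun, Complex.normSq_mk, ← hm, ← ht, ← hE]; ring
  have hw : 2 * m * (2 * t * deriv (profile s) (t ^ 2 - 1) - 1 / 100 * x) = 0 := by
    -- The function depends on w only through |w|², so the radial direction carries all the
    -- information. It is nondegenerate because t² < 4 excludes w = 0.
    have h1 := line (0, w)
    have h2 : HasDerivAt (fun e : ℝ => profile s (((1 + e) ^ 2 * m - 4) ^ 2 - 1)
        - 1 / 100 * x * ((1 + e) ^ 2 * m - 4) - Q + Q ^ 2)
        (2 * m * (2 * t * deriv (profile s) (t ^ 2 - 1) - 1 / 100 * x)) 0 := by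
      have ha : HasDerivAt (fun e : ℝ => 1 + e) 1 0 := (hasDerivAt_id (0 : ℝ)).const_add 1
      have hb := ((ha.pow 2).mul_const m).sub_const 4
      have hc := (hb.pow 2).sub_const 1
      have hP : HasDerivAt (profile s) (deriv (profile s) (t ^ 2 - 1)) (t ^ 2 - 1) :=
        ((contDiff_profile hs).differentiable (by simp) _).hasDerivAt
      have hPc := HasDerivAt.comp_of_eq (0 : ℝ) hP hc (by simp [ht])
      refine (((hPc.sub (hb.const_mul (1 / 100 * x))).sub_const Q).add_const
        (Q ^ 2)).congr_deriv ?_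
      simp [ht]; ring
    refine h2.unique (h1.congr_of_eventuallyEq (Eventually.of_forall fun e => ?_))
    have : Complex.normSq (w + e * w) = (1 + e) ^ 2 * m := by
      rw [hm, show w + (e : ℂ) * w = ((1 + e : ℝ) : ℂ) * w by push_cast; ring, Complex.normSq_mul,
        Complex.normSq_ofReal]; ring
    simp [pinchedDefFun, this, hQ, Complex.normSq_mk]; ring
  have hm0 : m ≠ 0 := by
    intro h; rw [ht, h] at ht4; norm_num at ht4
  have hw' : 2 * t * deriv (profile s) (t ^ 2 - 1) = 1 / 100 * x := by
    have := (mul_eq_zero.1 hw).resolve_left (by positivity)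
    linarith
  exact no_critical_point hs ht4 hρ hx hy hw'

lemma smooth_boundary_pinchedDomain {s : ℝ} (hs : 0 < s) : ∀ p ∈ frontier (pinchedDomain s),
    ∃ U : Set (ℂ × ℂ), IsOpen U ∧ p ∈ U ∧ ∃ ρ : ℂ × ℂ → ℝ, ContDiffOn ℝ ∞ ρ U ∧
      fderiv ℝ ρ p ≠ 0 ∧ pinchedDomain s ∩ U = {x ∈ U | ρ x < 0} := by
  intro p hp
  have h0 : pinchedDefFun s p = 0 :=
    frontier_lt_subset_eq (contDiff_pinchedDefFun hs).continuous continuous_const hp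
  exact ⟨univ, isOpen_univ, mem_univ p, pinchedDefFun s, (contDiff_pinchedDefFun hs).contDiffOn,
    fderiv_pinchedDefFun_ne_zero hs h0, by ext; simp [pinchedDomain]⟩

/-! ### Failure of pseudoconvexity. -/

/-- Here w = 2 + ω and z = 1/2 + σ - ω/25 with ω = a + iv, and E is replaced by its bound 3/16. The
slope -1/25 is the complex tangent direction at (1/2, 2), so the terms linear in ω cancel at σ = 0.
The negative term -|ω|²/200, coming from |w|² times the mixed term, dominates the second order. -/
lemma concave_disc_estimate {σ a v : ℝ} (h0 : 0 ≤ σ) (h1 : σ ≤ 1 / 100)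
    (hN : a ^ 2 + v ^ 2 ≤ 1 / 100) (hpos : 0 < σ + (a ^ 2 + v ^ 2)) :
    3 / 16 - 1 / 100 * (4 * a + (a ^ 2 + v ^ 2)) * (1 / 2 + σ - a / 25)
      - ((1 / 2 + σ - a / 25) ^ 2 + (v / 25) ^ 2)
      + ((1 / 2 + σ - a / 25) ^ 2 + (v / 25) ^ 2) ^ 2 < 0 := by
  set N := a ^ 2 + v ^ 2 with hNd
  have hN0 : 0 ≤ N := by positivity
  have ha : |a| ≤ 1 / 10 := abs_le_of_sq_le_sq (by nlinarith [sq_nonneg v]) (by norm_num)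
  obtain ⟨ha1, ha2⟩ := abs_le.1 ha
  set B := N / 625 + σ * (1 + σ - 2 * a / 25) with hB
  have hBl : 0 ≤ B := by
    have : 0 ≤ σ * (1 + σ - 2 * a / 25) := mul_nonneg h0 (by linarith)
    positivity
  have hBu : B ≤ N / 625 + 51 / 50 * σ := by nlinarith
  have hBu2 : B ≤ 1 / 50 := by linarith
  have hQ : (1 / 2 + σ - a / 25) ^ 2 + (v / 25) ^ 2 = 1 / 4 - a / 25 + B := by
    rw [hB, hNd]; ring
  rw [hQ]
  have haN : a ^ 2 ≤ N := by nlinarith [sq_nonneg v]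
  have hd : (-a / 25 + B) ^ 2 ≤ a ^ 2 / 625 + 1 / 25 * B := by nlinarith
  have hNa : N * a ≤ N / 10 := by nlinarith
  have hNs : 0 ≤ N * σ := by positivity
  have key : 3 / 16 - 1 / 100 * (4 * a + N) * (1 / 2 + σ - a / 25) - (1 / 4 - a / 25 + B)
      + (1 / 4 - a / 25 + B) ^ 2 = -(N / 200) - N / 1250 - σ / 2 - σ ^ 2 / 2 - N * σ / 100
      + a ^ 2 / 625 + N * a / 2500 + (-a / 25 + B) ^ 2 := by
    rw [hB]; ring
  rw [key]
  nlinarith [sq_nonneg σ]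

lemma not_isPseudoconvex_pinchedDomain {s : ℝ} (hs : 0 < s) :
    ¬ IsPseudoconvex (pinchedDomain s) := by
  rintro ⟨u, hu, hex⟩
  -- Discs with centres tending to the boundary point (1/2, 2) and with complex tangent direction
  -- `b`, where ω = τ/10.
  let c : ℝ → ℂ × ℂ := fun σ => ((1 / 2 + σ : ℝ), 2)
  let b : ℂ × ℂ := (-1 / 250, 1 / 10)
  have hmem : ∀ σ : ℝ, ∀ τ : ℂ, 0 ≤ σ → σ ≤ 1 / 100 → ‖τ‖ ≤ 1 → 0 < σ + ‖τ‖ →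
      c σ + τ • b ∈ pinchedDomain s := by
    intro σ τ h0 h1 hτ hpos
    have hτ2 : τ.re ^ 2 + τ.im ^ 2 = ‖τ‖ ^ 2 := by
      rw [← Complex.normSq_eq_norm_sq, Complex.normSq_apply]; ring
    have hle : ‖τ‖ ^ 2 ≤ 1 := by nlinarith [norm_nonneg τ]
    have hN : (τ.re / 10) ^ 2 + (τ.im / 10) ^ 2 = ‖τ‖ ^ 2 / 100 := by rw [← hτ2]; ring
    have hest := concave_disc_estimate (a := τ.re / 10) (v := τ.im / 10) h0 h1
      (by rw [hN]; linarith) (by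
        rw [hN]
        rcases h0.eq_or_lt with rfl | h
        · have : 0 < ‖τ‖ := by linarith
          positivity
        · positivity)
    rw [hN] at hest
    have hnw : Complex.normSq (c σ + τ • b).2 - 4 = 4 * (τ.re / 10) + ‖τ‖ ^ 2 / 100 := by
      rw [← hτ2]; simp [c, b, Complex.normSq_apply]; ring
    have hnz : Complex.normSq (c σ + τ • b).1 =
        (1 / 2 + σ - τ.re / 10 / 25) ^ 2 + (τ.im / 10 / 25) ^ 2 := by
      simp [c, b, Complex.normSq_apply]; ring
    have hre : (c σ + τ • b).1.re = 1 / 2 + σ - τ.re / 10 / 25 := by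
      simp [c, b]; ring
    have hxle := abs_le.1 ((Complex.abs_re_le_norm τ).trans hτ)
    change pinchedDefFun s _ < 0
    unfold pinchedDefFun
    rw [hnw, hnz, hre]
    have hE := profile_le_of_mem hs (u := (4 * (τ.re / 10) + ‖τ‖ ^ 2 / 100) ^ 2 - 1)
      (by nlinarith [sq_nonneg (4 * (τ.re / 10) + ‖τ‖ ^ 2 / 100)])
      (by nlinarith [sq_nonneg (‖τ‖ ^ 2)])
    linarith
  have hcc : Continuous fun q : ℝ × ℂ => c q.1 + q.2 • b := by
    simp only [c]; fun_prop
  have hK : IsCompact ((fun q : ℝ × ℂ => c q.1 + q.2 • b) ''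
      (Icc 0 (1 / 100) ×ˢ Metric.sphere (0 : ℂ) 1)) :=
    (isCompact_Icc.prod (isCompact_sphere _ _)).image hcc
  -- Even at σ = 0 only the centre leaves the domain, so the bounding circles fill a compact subset
  -- of it. The mean value inequality then bounds u at the centres as they approach the boundary.
  obtain ⟨M, hM⟩ := hK.bddAbove_image (f := u) (hu.continuousOn.mono (by
    rintro _ ⟨⟨σ, τ⟩, ⟨⟨h0, h1⟩, hτ⟩, rfl⟩
    rw [mem_sphere_zero_iff_norm] at hτ
    exact hmem σ τ h0 h1 hτ.le (by simp only at h0; linarith)))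
  have hval : ∀ σ ∈ Ioc (0 : ℝ) (1 / 100), c σ ∈ {z ∈ pinchedDomain s | u z < M + 1} := by
    intro σ hσ
    have hin : ∀ τ : ℂ, ‖τ‖ ≤ 1 → c σ + τ • b ∈ pinchedDomain s := fun τ hτ =>
      hmem σ τ hσ.1.le hσ.2 hτ (by linarith [hσ.1, norm_nonneg τ])
    refine ⟨by simpa using hin 0 (by simp), ?_⟩
    have havg : Real.circleAverage (fun τ : ℂ => u (c σ + τ • b)) 0 1 ≤ M := by
      refine Real.circleAverage_mono_on_of_le_circle ?_ ?_
      · refine ContinuousOn.circleIntegrable zero_le_one ?_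
        refine hu.continuousOn.comp (by fun_prop) fun τ hτ => hin τ ?_
        rw [mem_sphere_zero_iff_norm] at hτ; exact hτ.le
      · intro τ hτ
        rw [abs_one] at hτ
        exact hM ⟨_, ⟨(σ, τ), ⟨⟨hσ.1.le, hσ.2⟩, hτ⟩, rfl⟩, rfl⟩
    have := hu.le_average (c σ) b hin
    linarith
  have hcl : c 0 ∈ closure {z ∈ pinchedDomain s | u z < M + 1} := by
    have hc : Tendsto c (𝓝[>] 0) (𝓝 (c 0)) :=
      (Continuous.tendsto (by simp only [c]; fun_prop) 0).mono_left nhdsWithin_le_nhds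
    refine mem_closure_of_tendsto hc ?_
    filter_upwards [Ioc_mem_nhdsGT (show (0 : ℝ) < 1 / 100 by norm_num)] with σ hσ
      using hval σ hσ
  have h0 : pinchedDefFun s (c 0) < 0 := (hex (M + 1)).2 hcl
  have : pinchedDefFun s (c 0) = 0 := by
    simp only [pinchedDefFun, c, Complex.normSq_apply]
    norm_num [profile_neg_one]
  linarith

/-! ### Connectedness. -/

/-- Polar coordinates on `ℂ × {|w|² ≥ 0}`, with `|w|² = 4 + t` as third coordinate. -/
noncomputable def bipolar (r θ t φ : ℝ) : ℂ × ℂ :=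
  (r * Complex.exp (θ * Complex.I), Real.sqrt (4 + t) * Complex.exp (φ * Complex.I))

lemma bipolar_mem_pinchedDomain {s r θ t φ : ℝ} (ht : -4 ≤ t) :
    bipolar r θ t φ ∈ pinchedDomain s ↔
      profile s (t ^ 2 - 1) < 1 / 100 * t * (r * Real.cos θ) + r ^ 2 - r ^ 4 := by
  have h1 : Complex.normSq (bipolar r θ t φ).1 = r ^ 2 := by
    simp [bipolar, Complex.normSq_mul, Complex.normSq_eq_norm_sq (Complex.exp _),
      Complex.norm_exp_ofReal_mul_I, sq]
  have h2 : Complex.normSq (bipolar r θ t φ).2 = 4 + t := by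
    simp [bipolar, Complex.normSq_mul, Complex.normSq_eq_norm_sq (Complex.exp _),
      Complex.norm_exp_ofReal_mul_I]
    exact Real.mul_self_sqrt (by linarith)
  have h3 : (bipolar r θ t φ).1.re = r * Real.cos θ := by
    rw [bipolar, Complex.re_ofReal_mul, Complex.exp_ofReal_mul_I_re]
  change pinchedDefFun s _ < 0 ↔ _
  unfold pinchedDefFun
  rw [h1, h2, h3, show (4 + t - 4 : ℝ) = t by ring]
  constructor <;> intro h <;> nlinarith

lemma joinedIn_bipolar {s : ℝ} (r θ t φ : ℝ → ℝ) (hr : Continuous r) (hθ : Continuous θ)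
    (ht : Continuous t) (hφ : Continuous φ)
    (h : ∀ a ∈ Icc (0 : ℝ) 1, -4 ≤ t a ∧ profile s (t a ^ 2 - 1) <
      1 / 100 * t a * (r a * Real.cos (θ a)) + r a ^ 2 - r a ^ 4) {p q : ℂ × ℂ}
    (hp : bipolar (r 0) (θ 0) (t 0) (φ 0) = p) (hq : bipolar (r 1) (θ 1) (t 1) (φ 1) = q) :
    JoinedIn (pinchedDomain s) p q := by
  refine JoinedIn.ofLine (f := fun a => bipolar (r a) (θ a) (t a) (φ a)) ?_ hp hq ?_
  · unfold bipolar; fun_prop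
  · rintro _ ⟨a, ha, rfl⟩
    exact (bipolar_mem_pinchedDomain (h a ha).1).2 (h a ha).2

/-- The quotient of `profile s (a ^ 2 - 1)` by a is nondecreasing for a ≥ 1, since exp(a² - b²) ≥
a/b already. It compares the profile with a right side that is affine in t. -/
lemma profile_sq_mul_le {s a b : ℝ} (hs : 0 < s) (h1 : 1 ≤ b) (hab : b ≤ a) :
    profile s (b ^ 2 - 1) * a ≤ profile s (a ^ 2 - 1) * b := by
  rw [profile_of_nonneg (by nlinarith), profile_of_nonneg (by nlinarith)]
  have hm := monotone_flatPow_zero hs (show b ^ 2 - 1 ≤ a ^ 2 - 1 by nlinarith)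
  have h0 := flatPow_nonneg s 0 (b ^ 2 - 1)
  have he : Real.exp (b ^ 2 - 1) * a ≤ Real.exp (a ^ 2 - 1) * b := by
    have : Real.exp (a ^ 2 - 1) = Real.exp (b ^ 2 - 1) * Real.exp (a ^ 2 - b ^ 2) := by
      rw [← Real.exp_add]; ring_nf
    rw [this, mul_assoc]
    have h2 := Real.add_one_le_exp (a ^ 2 - b ^ 2)
    have h3 : a ≤ (a ^ 2 - b ^ 2 + 1) * b := by
      nlinarith [mul_nonneg (sub_nonneg.2 hab) (sub_nonneg.2 h1), mul_pos (show (0:ℝ) < b by linarith) (show (0:ℝ) < a by linarith)]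
    gcongr
    exact h3.trans (by gcongr)
  calc _ = 3 / 16 * Real.exp 1 * ((Real.exp (b ^ 2 - 1) * a) * flatPow s 0 (b ^ 2 - 1)) := by ring
    _ ≤ 3 / 16 * Real.exp 1 * ((Real.exp (a ^ 2 - 1) * b) * flatPow s 0 (a ^ 2 - 1)) := by
      have : 0 ≤ Real.exp (a ^ 2 - 1) * b := by positivity
      gcongr
    _ = _ := by ring

/-- Moving `t` to `1` keeps the defining inequality of the fibres. -/
lemma profile_lt_of_between {s a b P c : ℝ} (hs : 0 < s) (ha : 0 ≤ a) (hb : 0 ≤ b) (hP : 0 ≤ P)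
    (hc : (a ≤ c ∧ c ≤ 1) ∨ (1 ≤ c ∧ c ≤ a)) (h : profile s (a ^ 2 - 1) < b * a + P) :
    profile s (c ^ 2 - 1) < b * c + P := by
  rcases hc with ⟨h1, h2⟩ | ⟨h1, h2⟩
  · have := profile_anti hs (show a ^ 2 - 1 ≤ c ^ 2 - 1 by nlinarith) (by nlinarith)
    nlinarith
  -- Scaling the inequality at a by c/a ≤ 1 leaves the constant term P ≥ 0 to spare.
  · have h3 := profile_sq_mul_le hs h1 h2
    have h4 : profile s (c ^ 2 - 1) * a < (b * c + P) * a := by nlinarith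
    exact lt_of_mul_lt_mul_right h4 ha

lemma profile_lt_of_sq_eq_one {s τ b : ℝ} (hτ : τ ^ 2 = 1) (h0 : 0 < b) (h1 : b ≤ 1) :
    profile s (τ ^ 2 - 1) < 1 / 100 * τ * (τ * b * Real.cos 0) + (τ * b) ^ 2 - (τ * b) ^ 4 := by
  rw [hτ, sub_self, profile_zero, Real.cos_zero]
  have h4 : (τ * b) ^ 4 = b ^ 4 := by rw [mul_pow, show τ ^ 4 = (τ ^ 2) ^ 2 by ring, hτ]; ring
  have h2 : (τ * b) ^ 2 = b ^ 2 := by rw [mul_pow, hτ]; ring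
  have h3 : 1 / 100 * τ * (τ * b * 1) = 1 / 100 * b := by linear_combination (1 / 100 * b) * hτ
  rw [h4, h2, h3]
  have : b ^ 4 ≤ b ^ 2 := pow_le_pow_of_le_one h0.le h1 (by norm_num)
  linarith

/-- At |z| = 7/10 one has Q - Q² = 0.2499, more than 3/16 plus the mixed term, so t can cross from
-1 to 1. A half turn of z then corrects the sign of the radius. -/
lemma joinedIn_bipolar_neg_one_one {s : ℝ} (hs : 0 < s) : JoinedIn (pinchedDomain s) (bipolar (-1 * (7 / 10)) 0 (-1) 0)
    (bipolar (1 * (7 / 10)) 0 1 0) := by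
  have s1 : JoinedIn (pinchedDomain s) (bipolar (-1 * (7 / 10)) 0 (-1) 0)
      (bipolar (-1 * (7 / 10)) 0 1 0) := by
    refine joinedIn_bipolar (fun _ => -1 * (7 / 10)) (fun _ => 0) (fun a => -1 + 2 * a)
      (fun _ => 0) (by fun_prop) (by fun_prop) (by fun_prop) (by fun_prop) ?_ (by norm_num)
      (by norm_num)
    rintro a ⟨h0, h1⟩
    refine ⟨by linarith, ?_⟩
    have := profile_le_of_mem hs (u := (-1 + 2 * a) ^ 2 - 1) (by nlinarith) (by nlinarith)
    rw [Real.cos_zero]; norm_num at this ⊢; linarith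
  have s2 : JoinedIn (pinchedDomain s) (bipolar (-1 * (7 / 10)) 0 1 0)
      (bipolar (1 * (7 / 10)) 0 1 0) := by
    refine joinedIn_bipolar (fun _ => -1 * (7 / 10)) (fun a => Real.pi * a) (fun _ => 1)
      (fun _ => 0) (by fun_prop) (by fun_prop) (by fun_prop) (by fun_prop) ?_ (by norm_num)
      (by simp [bipolar, Complex.exp_pi_mul_I])
    rintro a ⟨h0, h1⟩
    refine ⟨by norm_num, ?_⟩
    have := Real.cos_le_one (Real.pi * a)
    norm_num [profile_zero]; linarith
  exact s1.trans s2

/-- With z real of the same sign as t, first move t to ±1, where the profile vanishes; there |z| can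
be changed freely within (0, 1]. -/
lemma joinedIn_bipolar_sign {s τ t d : ℝ} (hs : 0 < s) (hτ : τ = 1 ∨ τ = -1) (ht4 : -4 ≤ t)
    (hsgn : 0 ≤ τ * t) (hd0 : 0 < d) (hd1 : d ≤ 1)
    (hpd : profile s (t ^ 2 - 1) < 1 / 100 * t * (τ * d) + d ^ 2 - d ^ 4) :
    JoinedIn (pinchedDomain s) (bipolar (τ * d) 0 t 0) (bipolar (τ * (7 / 10)) 0 τ 0) := by
  have hτ2 : τ ^ 2 = 1 := by rcases hτ with rfl | rfl <;> norm_num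
  have h3 : JoinedIn (pinchedDomain s) (bipolar (τ * d) 0 t 0) (bipolar (τ * d) 0 τ 0) := by
    refine joinedIn_bipolar (fun _ => τ * d) (fun _ => 0) (fun a => t + a * (τ - t))
      (fun _ => 0) (by fun_prop) (by fun_prop) (by fun_prop) (by fun_prop) ?_
      (by norm_num) (by norm_num)
    rintro a ⟨ha0, ha1⟩
    have hτl : -1 ≤ τ := by rcases hτ with rfl | rfl <;> norm_num
    refine ⟨by nlinarith, ?_⟩
    have e4 : τ ^ 4 = 1 := by rw [show τ ^ 4 = (τ ^ 2) ^ 2 by ring, hτ2]; norm_num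
    rw [mul_pow, mul_pow, hτ2, e4, one_mul, one_mul, Real.cos_zero, mul_one]
    have hP : 0 ≤ d ^ 2 - d ^ 4 := by
      have : d ^ 4 ≤ d ^ 2 := pow_le_pow_of_le_one hd0.le hd1 (by norm_num)
      linarith
    have hsq : (τ * t) ^ 2 = t ^ 2 := by rw [mul_pow, hτ2, one_mul]
    have key := profile_lt_of_between (s := s) (a := τ * t) (b := 1 / 100 * d)
      (P := d ^ 2 - d ^ 4) (c := τ * t + a * (1 - τ * t)) hs hsgn (by positivity) hP
      (by
        rcases le_total (τ * t) 1 with h | h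
        · left; constructor <;> nlinarith
        · right; constructor <;> nlinarith)
      (by rw [hsq]; linarith)
    have e1 : τ * t + a * (1 - τ * t) = τ * (t + a * (τ - t)) := by
      linear_combination (-a) * hτ2
    rw [e1, mul_pow, hτ2, one_mul] at key
    linarith
  have h4 : JoinedIn (pinchedDomain s) (bipolar (τ * d) 0 τ 0)
      (bipolar (τ * (7 / 10)) 0 τ 0) := by
    refine joinedIn_bipolar (fun a => τ * (d + a * (7 / 10 - d))) (fun _ => 0) (fun _ => τ)
      (fun _ => 0) (by fun_prop) (by fun_prop) (by fun_prop) (by fun_prop) ?_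
      (by norm_num) (by norm_num)
    rintro a ⟨ha0, ha1⟩
    refine ⟨by rcases hτ with rfl | rfl <;> norm_num, profile_lt_of_sq_eq_one hτ2 ?_ ?_⟩
    · rcases ha0.eq_or_lt with rfl | h
      · simpa using hd0
      · nlinarith
    · nlinarith
  exact h3.trans h4

/-- Every point is joined to a base point by rotating z until t Re z is largest, rotating w to the
positive axis, shrinking |z| to 1 if it is larger, and applying `joinedIn_bipolar_sign`. -/
lemma isConnected_pinchedDomain {s : ℝ} (hs : 0 < s) : IsConnected (pinchedDomain s) := by
  have hbase := joinedIn_bipolar_neg_one_one hs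
  have hmain : ∀ p ∈ pinchedDomain s,
      JoinedIn (pinchedDomain s) p (bipolar (1 * (7 / 10)) 0 1 0) := by
    intro p hp
    obtain ⟨τ, hτ, hsgn⟩ : ∃ τ : ℝ, (τ = 1 ∨ τ = -1) ∧ 0 ≤ τ * (Complex.normSq p.2 - 4) := by
      rcases le_total 0 (Complex.normSq p.2 - 4) with h | h
      · exact ⟨1, Or.inl rfl, by linarith⟩
      · exact ⟨-1, Or.inr rfl, by linarith⟩
    have hτ2 : τ ^ 2 = 1 := by rcases hτ with rfl | rfl <;> norm_num
    set t := Complex.normSq p.2 - 4 with ht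
    -- The angle is measured from the half-line where t Re z ≥ 0, so shrinking it to 0 only
    -- increases the mixed term.
    set θ := Complex.arg (τ * p.1) with hθ
    set φ := Complex.arg p.2
    set b := ‖p.1‖ with hb
    have ht4 : -4 ≤ t := by linarith [Complex.normSq_nonneg p.2]
    have hpe : bipolar (τ * b) θ t φ = p := by
      unfold bipolar
      refine Prod.ext ?_ ?_
      · have hn : ‖(τ : ℂ) * p.1‖ = b := by
          rw [norm_mul]; rcases hτ with rfl | rfl <;> simp [hb]
        have h := Complex.norm_mul_exp_arg_mul_I ((τ : ℂ) * p.1)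
        rw [hn] at h
        change ((τ * b : ℝ) : ℂ) * Complex.exp (θ * Complex.I) = p.1
        push_cast
        rw [mul_assoc, h, ← mul_assoc]
        have : (τ : ℂ) * τ = 1 := by rw [← Complex.ofReal_mul, ← sq, hτ2]; simp
        rw [this, one_mul]
      · change (Real.sqrt (4 + t) : ℂ) * Complex.exp (φ * Complex.I) = p.2
        rw [ht, add_sub_cancel, Complex.normSq_eq_norm_sq, Real.sqrt_sq (norm_nonneg _)]
        exact Complex.norm_mul_exp_arg_mul_I p.2
    have hp' := hp
    rw [← hpe, bipolar_mem_pinchedDomain ht4] at hp'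
    have hb0 : 0 < b := by
      refine lt_of_le_of_ne (norm_nonneg _) fun h => ?_
      rw [← h] at hp'
      have := profile_nonneg s (t ^ 2 - 1)
      norm_num at hp'; linarith
    have hb2 : (τ * b) ^ 2 = b ^ 2 := by rw [mul_pow, hτ2, one_mul]
    have hb4 : (τ * b) ^ 4 = b ^ 4 := by rw [show (τ * b) ^ 4 = ((τ * b) ^ 2) ^ 2 by ring, hb2]; ring
    have htb : 0 ≤ t * (τ * b) := by nlinarith
    have h1 : JoinedIn (pinchedDomain s) p (bipolar (τ * b) 0 t 0) := by
      refine joinedIn_bipolar (fun _ => τ * b) (fun a => (1 - a) * θ) (fun _ => t)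
        (fun a => (1 - a) * φ) (by fun_prop) (by fun_prop) (by fun_prop) (by fun_prop) ?_
        (by simpa using hpe) (by norm_num)
      rintro a ⟨h0, h1⟩
      refine ⟨ht4, hp'.trans_le ?_⟩
      have hcos : Real.cos θ ≤ Real.cos ((1 - a) * θ) := by
        rw [← Real.cos_abs θ, ← Real.cos_abs ((1 - a) * θ)]
        refine Real.cos_le_cos_of_nonneg_of_le_pi (abs_nonneg _) (Complex.abs_arg_le_pi _) ?_
        rw [abs_mul, abs_of_nonneg (by linarith : 0 ≤ 1 - a)]
        nlinarith [abs_nonneg θ]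
      nlinarith
    have hp0 : profile s (t ^ 2 - 1) < 1 / 100 * t * (τ * b) + b ^ 2 - b ^ 4 := by
      have := h1.target_mem
      rw [bipolar_mem_pinchedDomain ht4, hb2, hb4, Real.cos_zero, mul_one] at this
      exact this
    obtain ⟨d, hd0, hd1, hpd, h2⟩ : ∃ d : ℝ, 0 < d ∧ d ≤ 1 ∧
        profile s (t ^ 2 - 1) < 1 / 100 * t * (τ * d) + d ^ 2 - d ^ 4 ∧
        JoinedIn (pinchedDomain s) p (bipolar (τ * d) 0 t 0) := by
      rcases le_or_gt b 1 with hb1 | hb1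
      · exact ⟨b, hb0, hb1, hp0, h1⟩
      · have ht2 := (bounds_of_pinchedDefFun_nonpos hs (le_of_lt hp)).1
        rw [← ht] at ht2
        have hτt : τ * t ≤ 2 := by nlinarith
        -- Beyond modulus 1 the decrease of c² - c⁴ outweighs the mixed term, so shrinking c stays
        -- inside.
        have hmono : ∀ c : ℝ, 1 ≤ c → c ≤ b →
            profile s (t ^ 2 - 1) < 1 / 100 * t * (τ * c) + c ^ 2 - c ^ 4 := by
          intro c hc1 hcb
          refine hp0.trans_le ?_
          have e : 1 / 100 * t * (τ * c) + c ^ 2 - c ^ 4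
              - (1 / 100 * t * (τ * b) + b ^ 2 - b ^ 4)
              = (b - c) * ((b + c) * (b ^ 2 + c ^ 2 - 1) - 1 / 100 * (τ * t)) := by ring
          have h3 : 1 ≤ b ^ 2 + c ^ 2 - 1 := by nlinarith
          have h4 : 0 ≤ (b + c) * (b ^ 2 + c ^ 2 - 1) - 1 / 100 * (τ * t) := by nlinarith
          have := mul_nonneg (sub_nonneg.2 hcb) h4
          linarith
        refine ⟨1, one_pos, le_rfl, hmono 1 le_rfl hb1.le, h1.trans ?_⟩
        refine joinedIn_bipolar (fun a => τ * (b + a * (1 - b))) (fun _ => 0) (fun _ => t)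
          (fun _ => 0) (by fun_prop) (by fun_prop) (by fun_prop) (by fun_prop) ?_
          (by norm_num) (by norm_num)
        rintro a ⟨ha0, ha1⟩
        refine ⟨ht4, ?_⟩
        have := hmono (b + a * (1 - b)) (by nlinarith) (by nlinarith)
        have e4 : τ ^ 4 = 1 := by rw [show τ ^ 4 = (τ ^ 2) ^ 2 by ring, hτ2]; norm_num
        rw [mul_pow, mul_pow, hτ2, e4, one_mul, one_mul, Real.cos_zero, mul_one]
        exact this
    refine (h2.trans (joinedIn_bipolar_sign hs hτ ht4 hsgn hd0 hd1 hpd)).trans ?_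
    rcases hτ with rfl | rfl
    · exact JoinedIn.refl hbase.target_mem
    · exact hbase
  exact IsPathConnected.isConnected ⟨_, hbase.target_mem, fun {y} hy => (hmain y hy).symm⟩

lemma isSmoothBoundedDomain_pinchedDomain {s : ℝ} (hs : 0 < s) :
    IsSmoothBoundedDomain (pinchedDomain s) :=
  ⟨isOpen_pinchedDomain hs, isConnected_pinchedDomain hs, isBounded_pinchedDomain hs,
    smooth_boundary_pinchedDomain hs⟩

/-! ### Sub-mean value inequalities and point evaluations. -/

/-- Polar coordinates reduce planar estimates to one circle at a time, for discs and annuli alike.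
-/
lemma lintegral_eq_lintegral_circleMap (c : ℂ) {G : ℂ → ℝ≥0∞} (hG : Measurable G) :
    ∫⁻ z, G z = ∫⁻ r in Ioi (0 : ℝ), ENNReal.ofReal r *
      ∫⁻ θ in Ioo (-Real.pi) Real.pi, G (circleMap c r θ) := by
  have h0 : ∫⁻ z, G z = ∫⁻ z, G (c + z) := (lintegral_add_left_eq_self G c).symm
  rw [h0, ← Complex.lintegral_comp_polarCoord_symm, polarCoord_target,
    Measure.volume_eq_prod, ← Measure.prod_restrict]
  have hsymm : ∀ p : ℝ × ℝ, c + Complex.polarCoord.symm p = circleMap c p.1 p.2 := by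
    intro p
    rw [Complex.polarCoord_symm_apply, circleMap, Complex.exp_mul_I]
    simp
  simp_rw [hsymm]
  have hm : Measurable fun p : ℝ × ℝ => G (circleMap c p.1 p.2) :=
    hG.comp (by fun_prop : Continuous fun p : ℝ × ℝ => circleMap c p.1 p.2).measurable
  rw [lintegral_prod _ (by
    simp only [smul_eq_mul]
    exact ((ENNReal.measurable_ofReal.comp measurable_fst).mul hm).aemeasurable)]
  refine lintegral_congr fun r => ?_
  simp only [smul_eq_mul]
  rw [lintegral_const_mul]
  exact hm.comp (by fun_prop : Measurable fun θ : ℝ => (r, θ))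

lemma lintegral_mono_of_circleMap (c : ℂ) {G H : ℂ → ℝ≥0∞} (hG : Measurable G) (hH : Measurable H)
    (h : ∀ r : ℝ, 0 < r → ∫⁻ θ in Ioo (-Real.pi) Real.pi, G (circleMap c r θ) ≤
      ∫⁻ θ in Ioo (-Real.pi) Real.pi, H (circleMap c r θ)) :
    ∫⁻ z, G z ≤ ∫⁻ z, H z := by
  rw [lintegral_eq_lintegral_circleMap c hG, lintegral_eq_lintegral_circleMap c hH]
  refine setLIntegral_mono' measurableSet_Ioi fun r hr => ?_
  gcongr ENNReal.ofReal r * ?_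
  exact h r hr

lemma enorm_circleAverage_mul_le (f : ℂ → ℂ) (c : ℂ) (R : ℝ) :
    ‖Real.circleAverage f c R‖ₑ * ENNReal.ofReal (2 * Real.pi) ≤
      ∫⁻ θ in Ioo (-Real.pi) Real.pi, ‖f (circleMap c R θ)‖ₑ := by
  have hpi : (0 : ℝ) < 2 * Real.pi := Real.two_pi_pos
  rw [Real.circleAverage_eq_integral_add (-Real.pi),
    intervalIntegral.integral_comp_add_right (fun θ => f (circleMap c R θ)), enorm_smul, mul_comm,
    ← mul_assoc, show ENNReal.ofReal (2 * Real.pi) * ‖(2 * Real.pi)⁻¹‖ₑ = 1 by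
      rw [Real.enorm_eq_ofReal (inv_nonneg.2 hpi.le), ← ENNReal.ofReal_mul hpi.le,
        mul_inv_cancel₀ hpi.ne', ENNReal.ofReal_one], one_mul,
    intervalIntegral.integral_of_le (by linarith)]
  refine (enorm_integral_le_lintegral_enorm _).trans_eq ?_
  rw [show 0 + -Real.pi = -Real.pi by ring, show 2 * Real.pi + -Real.pi = Real.pi by ring,
    ← restrict_Ioo_eq_restrict_Ioc]

/-- Sub-mean value inequality over a measurable radial set. -/
lemma enorm_mul_volume_le_of_circle_le {c : ℂ} {A : Set ℝ} (hA : MeasurableSet A) {a : ℝ≥0∞}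
    {H : ℂ → ℝ≥0∞} (hH : Measurable H)
    (h : ∀ r ∈ A, 0 < r → a * ENNReal.ofReal (2 * Real.pi) ≤
      ∫⁻ θ in Ioo (-Real.pi) Real.pi, H (circleMap c r θ)) :
    a * volume {z : ℂ | ‖z - c‖ ∈ A} ≤ ∫⁻ z in {z : ℂ | ‖z - c‖ ∈ A}, H z := by
  have hS : MeasurableSet {z : ℂ | ‖z - c‖ ∈ A} :=
    (by fun_prop : Measurable fun z : ℂ => ‖z - c‖) hA
  rw [← setLIntegral_const, ← lintegral_indicator hS, ← lintegral_indicator hS]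
  refine lintegral_mono_of_circleMap c (measurable_const.indicator hS) (hH.indicator hS) ?_
  intro r hr
  by_cases hrA : r ∈ A
  · have : ∀ θ, circleMap c r θ ∈ {z : ℂ | ‖z - c‖ ∈ A} := fun θ => by
      simpa [circleMap, abs_of_pos hr] using hrA
    simp only [indicator_of_mem (this _)]
    refine le_trans (le_of_eq ?_) (h r hrA hr)
    rw [setLIntegral_const, Real.volume_Ioo]; ring_nf
  · have : ∀ θ, circleMap c r θ ∉ {z : ℂ | ‖z - c‖ ∈ A} := fun θ => by
      simpa [circleMap, abs_of_pos hr] using hrA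
    simp only [indicator_of_notMem (this _)]
    exact le_rfl

lemma ContinuousOn.measurable_indicator_enorm {X : Type*} [TopologicalSpace X] [MeasurableSpace X]
    [BorelSpace X] {f : X → ℂ} {U : Set X} (hf : ContinuousOn f U) (hU : MeasurableSet U) :
    Measurable (U.indicator fun x => ‖f x‖ₑ) := by
  classical
  rw [← piecewise_eq_indicator]
  exact ContinuousOn.measurable_piecewise hf.enorm continuous_zero.continuousOn hU

lemma enorm_mul_volume_ball_le {g : ℂ → ℂ} {c : ℂ} {δ : ℝ}
    (hg : DifferentiableOn ℂ g (Metric.ball c δ)) :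
    ‖g c‖ₑ * volume (Metric.ball c δ) ≤ ∫⁻ z in Metric.ball c δ, ‖g z‖ₑ := by
  have hB : {z : ℂ | ‖z - c‖ ∈ Iio δ} = Metric.ball c δ := by
    ext z; simp [dist_eq_norm]
  have key := enorm_mul_volume_le_of_circle_le (c := c) (A := Iio δ) measurableSet_Iio
    (a := ‖g c‖ₑ) (H := (Metric.ball c δ).indicator fun z => ‖g z‖ₑ)
    (hg.continuousOn.measurable_indicator_enorm measurableSet_ball) (by
      intro r hr h0
      have h1 : Real.circleAverage g c r = g c := by
        refine DiffContOnCl.circleAverage ?_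
        rw [abs_of_pos h0]
        exact (hg.mono (Metric.closedBall_subset_ball hr)).diffContOnCl_ball (Subset.refl _)
      rw [← h1]
      refine (enorm_circleAverage_mul_le g c r).trans_eq (lintegral_congr fun θ => ?_)
      rw [indicator_of_mem]
      rw [Metric.mem_ball, dist_eq_norm]
      simpa [circleMap, abs_of_pos h0] using hr)
  rw [hB] at key
  refine key.trans_eq (setLIntegral_congr_fun measurableSet_ball fun z hz => ?_)
  exact indicator_of_mem hz _

/-- A ball for the sup norm is a bidisc, so the one-variable inequality is applied in each variable.
-/
lemma enorm_mul_volume_ball_le_prod {f : ℂ × ℂ → ℂ} {p : ℂ × ℂ} {δ : ℝ} (hδ : 0 < δ)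
    (hf : DifferentiableOn ℂ f (Metric.ball p δ)) :
    ‖f p‖ₑ * volume (Metric.ball p δ) ≤ ∫⁻ q in Metric.ball p δ, ‖f q‖ₑ := by
  have hball : Metric.ball p δ = Metric.ball p.1 δ ×ˢ Metric.ball p.2 δ :=
    (ball_prod_same p.1 p.2 δ).symm
  have hm : AEMeasurable (fun q => ‖f q‖ₑ) (volume.restrict (Metric.ball p δ)) :=
    (hf.continuousOn.aemeasurable measurableSet_ball).enorm
  rw [hball] at hf hm ⊢
  rw [Measure.volume_eq_prod, ← Measure.prod_restrict] at hm ⊢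
  rw [lintegral_prod _ hm, Measure.prod_prod]
  have h1 : DifferentiableOn ℂ (fun z => f (z, p.2)) (Metric.ball p.1 δ) :=
    hf.comp (by fun_prop) fun z hz => ⟨hz, Metric.mem_ball_self hδ⟩
  calc ‖f p‖ₑ * (volume (Metric.ball p.1 δ) * volume (Metric.ball p.2 δ))
      = (‖f (p.1, p.2)‖ₑ * volume (Metric.ball p.1 δ)) * volume (Metric.ball p.2 δ) := by
        rw [mul_assoc]
    _ ≤ (∫⁻ z in Metric.ball p.1 δ, ‖f (z, p.2)‖ₑ) * volume (Metric.ball p.2 δ) := by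
        gcongr; exact enorm_mul_volume_ball_le h1
    _ = ∫⁻ z in Metric.ball p.1 δ, ‖f (z, p.2)‖ₑ * volume (Metric.ball p.2 δ) :=
        (lintegral_mul_const'' _ (h1.continuousOn.aemeasurable measurableSet_ball).enorm).symm
    _ ≤ _ := by
        refine setLIntegral_mono' measurableSet_ball fun z hz => ?_
        exact enorm_mul_volume_ball_le (g := fun w => f (z, w))
          (hf.comp (by fun_prop) fun w hw => ⟨hz, hw⟩)

/-- Point evaluations are bounded on the Bergman space, uniformly over points at distance at least
`δ` from the boundary. -/
lemma exists_enorm_le_eLpNorm {δ : ℝ} (hδ : 0 < δ) : ∃ C : ℝ≥0∞, C ≠ ⊤ ∧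
    ∀ (Ω : Set (ℂ × ℂ)) (f : ℂ × ℂ → ℂ) (p : ℂ × ℂ), Metric.ball p δ ⊆ Ω →
      DifferentiableOn ℂ f Ω → ‖f p‖ₑ ≤ C * eLpNorm f 2 (volume.restrict Ω) := by
  have hV : ∀ p : ℂ × ℂ, volume (Metric.ball p δ) = volume (Metric.ball (0 : ℂ × ℂ) δ) :=
    fun p => by rw [Measure.volume_eq_prod]; exact Measure.addHaar_ball_center _ _ _
  set V := volume (Metric.ball (0 : ℂ × ℂ) δ) with hVd
  have hV0 : V ≠ 0 := (Metric.measure_ball_pos _ _ hδ).ne'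
  have hVt : V ≠ ⊤ := measure_ball_lt_top.ne
  refine ⟨V ^ (1 / 2 : ℝ) / V, ENNReal.div_ne_top (by finiteness) hV0, ?_⟩
  intro Ω f p hp hf
  have h1 := enorm_mul_volume_ball_le_prod hδ (hf.mono hp)
  have hm : AEStronglyMeasurable f (volume.restrict (Metric.ball p δ)) :=
    (hf.mono hp).continuousOn.aestronglyMeasurable measurableSet_ball
  have h2 := eLpNorm_le_eLpNorm_mul_rpow_measure_univ (p := 1) (q := 2) (by norm_num) hm
  rw [eLpNorm_one_eq_lintegral_enorm, Measure.restrict_apply_univ, hV] at h2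
  have h3 : eLpNorm f 2 (volume.restrict (Metric.ball p δ)) ≤ eLpNorm f 2 (volume.restrict Ω) :=
    eLpNorm_mono_measure _ (Measure.restrict_mono hp le_rfl)
  rw [hV] at h1
  have h4 : ‖f p‖ₑ * V ≤ eLpNorm f 2 (volume.restrict Ω) * V ^ (1 / 2 : ℝ) := by
    refine h1.trans (h2.trans ?_)
    norm_num
    gcongr
  rw [mul_comm, ← mul_div_assoc, ENNReal.le_div_iff_mul_le (Or.inl hV0) (Or.inl hVt)]
  exact h4

/-! ### Completeness of the Bergman space, Riesz representation and the kernel. -/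

/-- Weierstrass' theorem: a Cauchy estimate for the differences makes the derivatives uniformly
Cauchy on the half-size ball, and limit and derivative can then be exchanged. -/
lemma differentiableAt_of_uniformCauchySeqOn {E : Type*} [NormedAddCommGroup E] [NormedSpace ℂ E]
    {F : ℕ → E → ℂ} {g : E → ℂ} {p : E} {δ : ℝ} (hδ : 0 < δ)
    (hd : ∀ n, DifferentiableOn ℂ (F n) (Metric.ball p (2 * δ)))
    (hu : UniformCauchySeqOn F atTop (Metric.ball p (2 * δ)))
    (hg : ∀ q ∈ Metric.ball p (2 * δ), Tendsto (fun n => F n q) atTop (𝓝 (g q))) :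
    DifferentiableAt ℂ g p := by
  have hsub : ∀ q ∈ Metric.ball p δ, Metric.ball q δ ⊆ Metric.ball p (2 * δ) := fun q hq =>
    Metric.ball_subset_ball' (by rw [Metric.mem_ball] at hq; linarith)
  have hda : ∀ n, ∀ q ∈ Metric.ball p δ, DifferentiableAt ℂ (F n) q := fun n q hq =>
    (hd n).differentiableAt (Metric.isOpen_ball.mem_nhds (hsub q hq (Metric.mem_ball_self hδ)))
  have hc : UniformCauchySeqOn (fun n => fderiv ℂ (F n)) atTop (Metric.ball p δ) := by
    rw [Metric.uniformCauchySeqOn_iff] at hu ⊢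
    intro ε hε
    obtain ⟨N, hN⟩ := hu (ε * δ / 4) (by positivity)
    refine ⟨N, fun m hm n hn q hq => ?_⟩
    rw [dist_eq_norm, ← fderiv_sub (hda m q hq) (hda n q hq)]
    have hb : ∀ y ∈ Metric.ball q δ, ‖(F m - F n) y‖ < ε * δ / 4 := fun y hy => by
      have := hN m hm n hn y (hsub q hq hy)
      rwa [dist_eq_norm] at this
    have := Complex.norm_fderiv_le_div_of_mapsTo_ball (f := F m - F n) (c := q) (R₁ := δ)
      (R₂ := ε * δ / 2) (((hd m).sub (hd n)).mono (hsub q hq)) (fun y hy => by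
        rw [mem_closedBall_iff_norm]
        have h1 := hb y hy
        have h2 := hb q (Metric.mem_ball_self hδ)
        have := norm_sub_le ((F m - F n) y) ((F m - F n) q)
        linarith) hδ
    refine this.trans_lt ?_
    rw [div_lt_iff₀ hδ]
    nlinarith [mul_pos hε hδ]
  have hlim : ∀ q ∈ Metric.ball p δ, ∃ L, Tendsto (fun n => fderiv ℂ (F n) q) atTop (𝓝 L) :=
    fun q hq => cauchySeq_tendsto_of_complete (hc.cauchySeq hq)
  choose! L hL using hlim
  exact (hasFDerivAt_of_tendstoUniformlyOn Metric.isOpen_ball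
    (hc.tendstoUniformlyOn_of_tendsto hL) (fun n q hq => (hda n q hq).hasFDerivAt)
    (fun q hq => hg q (Metric.ball_subset_ball (by linarith) hq))
    (Metric.mem_ball_self hδ)).differentiableAt

/-- The subspace of `L²(Ω)` of classes with a holomorphic representative. -/
def bergmanSubmodule (Ω : Set (ℂ × ℂ)) : Submodule ℂ (Lp ℂ 2 (volume.restrict Ω)) where
  carrier := {x | ∃ f : ℂ × ℂ → ℂ, DifferentiableOn ℂ f Ω ∧ x =ᵐ[volume.restrict Ω] f}
  add_mem' := by
    rintro x y ⟨f, hf, hxf⟩ ⟨g, hg, hyg⟩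
    exact ⟨f + g, hf.add hg, (Lp.coeFn_add x y).trans (hxf.add hyg)⟩
  zero_mem' := ⟨0, differentiableOn_const 0, Lp.coeFn_zero _ _ _⟩
  smul_mem' := by
    rintro c x ⟨f, hf, hxf⟩
    exact ⟨c • f, hf.const_smul c, (Lp.coeFn_smul c x).trans (hxf.const_smul c)⟩

lemma isClosed_bergmanSubmodule {Ω : Set (ℂ × ℂ)} (hΩ : IsOpen Ω) :
    IsClosed (bergmanSubmodule Ω : Set (Lp ℂ 2 (volume.restrict Ω))) := by
  refine IsSeqClosed.isClosed fun x y hx hxy => ?_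
  choose f hf hxf using hx
  have hcauchy : CauchySeq x := hxy.cauchySeq
  have hnorm : ∀ m n, eLpNorm (f m - f n) 2 (volume.restrict Ω) = edist (x m) (x n) := by
    intro m n
    rw [Lp.edist_def]
    exact eLpNorm_congr_ae ((hxf m).sub (hxf n)).symm
  have hunif : ∀ p ∈ Ω, ∃ δ > 0, Metric.ball p (2 * δ) ⊆ Ω ∧
      UniformCauchySeqOn f atTop (Metric.ball p (2 * δ)) := by
    intro p hp
    obtain ⟨ε, hε, hεΩ⟩ := Metric.isOpen_iff.1 hΩ p hp
    obtain ⟨C, hC, hCf⟩ := exists_enorm_le_eLpNorm (δ := ε / 2) (by positivity)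
    refine ⟨ε / 4, by positivity, (Metric.ball_subset_ball (by linarith)).trans hεΩ, ?_⟩
    rw [Metric.uniformCauchySeqOn_iff]
    intro e' he'
    suffices h : ∃ N, ∀ m ≥ N, ∀ n ≥ N, ∀ q ∈ Metric.ball p (2 * (ε / 4)),
        edist (f m q) (f n q) < ENNReal.ofReal e' by simpa only [edist_lt_ofReal] using h
    have he : 0 < ENNReal.ofReal e' := ENNReal.ofReal_pos.2 he'
    set e := ENNReal.ofReal e'
    rcases eq_or_ne C 0 with h0 | h0
    · refine ⟨0, fun m _ n _ q hq => ?_⟩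
      have := hCf Ω (f m - f n) q ((Metric.ball_subset_ball' (by
        rw [Metric.mem_ball] at hq; linarith)).trans hεΩ) ((hf m).sub (hf n))
      rw [h0, zero_mul, nonpos_iff_eq_zero] at this
      rw [edist_eq_enorm_sub]
      exact this ▸ he
    · obtain ⟨N, hN⟩ := EMetric.cauchySeq_iff.1 hcauchy (e / C)
        (ENNReal.div_pos he.ne' hC)
      refine ⟨N, fun m hm n hn q hq => ?_⟩
      have h1 := hCf Ω (f m - f n) q ((Metric.ball_subset_ball' (by
        rw [Metric.mem_ball] at hq; linarith)).trans hεΩ) ((hf m).sub (hf n))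
      rw [hnorm] at h1
      rw [edist_eq_enorm_sub]
      refine h1.trans_lt ?_
      have := hN m hm n hn
      rw [ENNReal.lt_div_iff_mul_lt (Or.inl h0) (Or.inl hC)] at this
      rwa [mul_comm]
  have hlim : ∀ p ∈ Ω, ∃ L, Tendsto (fun n => f n p) atTop (𝓝 L) := by
    intro p hp
    obtain ⟨δ, hδ, -, hu⟩ := hunif p hp
    exact cauchySeq_tendsto_of_complete (hu.cauchySeq (Metric.mem_ball_self (by positivity)))
  choose! g hg using hlim
  refine ⟨g, fun p hp => ?_, ?_⟩
  · obtain ⟨δ, hδ, hsub, hu⟩ := hunif p hp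
    exact (differentiableAt_of_uniformCauchySeqOn hδ (fun n => (hf n).mono hsub) hu
      fun q hq => hg q (hsub hq)).differentiableWithinAt
  -- The L² limit and the pointwise limit are identified along an almost everywhere convergent
  -- subsequence.
  · obtain ⟨φ, hφ, hae⟩ := (tendstoInMeasure_of_tendsto_Lp hxy).exists_seq_tendsto_ae
    filter_upwards [hae, ae_all_iff.2 hxf, ae_restrict_mem hΩ.measurableSet] with p h1 h2 hp
    refine tendsto_nhds_unique h1 ?_
    simp only [h2]
    exact (hg p hp).comp hφ.tendsto_atTop

/-- Riesz representation on the Bergman space. -/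
lemma exists_bergmanSpace_representer {Ω : Set (ℂ × ℂ)} (hΩ : IsOpen Ω) (Λ : (ℂ × ℂ → ℂ) → ℂ)
    (hadd : ∀ f ∈ bergmanSpace Ω, ∀ g ∈ bergmanSpace Ω, Λ (f + g) = Λ f + Λ g)
    (hsmul : ∀ c : ℂ, ∀ f ∈ bergmanSpace Ω, Λ (c • f) = c * Λ f) {C : ℝ≥0∞} (hC : C ≠ ⊤)
    (hbound : ∀ f ∈ bergmanSpace Ω, ‖Λ f‖ₑ ≤ C * eLpNorm f 2 (volume.restrict Ω)) :
    ∃ k ∈ bergmanSpace Ω, ∀ f ∈ bergmanSpace Ω, Λ f = ∫ ζ in Ω, f ζ * conj (k ζ) := by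
  -- `Λ` acts on total functions. Boundedness makes it depend only on the class in L², hence
  -- independent of the chosen representatives.
  have hcongr : ∀ f ∈ bergmanSpace Ω, ∀ g ∈ bergmanSpace Ω, f =ᵐ[volume.restrict Ω] g →
      Λ f = Λ g := by
    intro f hf g hg hfg
    have hneg : (-1 : ℂ) • g ∈ bergmanSpace Ω := ⟨hg.1.const_smul _, hg.2.const_smul _⟩
    have hdiff : f + (-1 : ℂ) • g ∈ bergmanSpace Ω := ⟨hf.1.add hneg.1, hf.2.add hneg.2⟩
    have h1 := hbound _ hdiff
    have h2 : eLpNorm (f + (-1 : ℂ) • g) 2 (volume.restrict Ω) = 0 := by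
      rw [eLpNorm_congr_ae (g := 0) (by filter_upwards [hfg] with x hx; simp [hx])]
      exact eLpNorm_zero
    rw [h2, mul_zero, nonpos_iff_eq_zero, enorm_eq_zero, hadd f hf _ hneg, hsmul _ g hg] at h1
    linear_combination h1
  have hrep : ∀ x : bergmanSubmodule Ω, ∃ f : ℂ × ℂ → ℂ, f ∈ bergmanSpace Ω ∧
      (x : Lp ℂ 2 (volume.restrict Ω)) =ᵐ[volume.restrict Ω] f := by
    rintro ⟨x, f, hf, hxf⟩
    exact ⟨f, ⟨hf, (memLp_congr_ae hxf).1 (Lp.memLp x)⟩, hxf⟩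
  choose rep hrepm hrepa using hrep
  let ℓ : bergmanSubmodule Ω →ₗ[ℂ] ℂ :=
    { toFun := fun x => Λ (rep x)
      map_add' := fun x y => by
        have hs : rep x + rep y ∈ bergmanSpace Ω :=
          ⟨(hrepm x).1.add (hrepm y).1, (hrepm x).2.add (hrepm y).2⟩
        rw [← hadd _ (hrepm x) _ (hrepm y)]
        refine hcongr _ (hrepm _) _ hs ?_
        exact (hrepa (x + y)).symm.trans ((Lp.coeFn_add _ _).trans ((hrepa x).add (hrepa y)))
      map_smul' := fun c x => by
        have hs : c • rep x ∈ bergmanSpace Ω :=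
          ⟨(hrepm x).1.const_smul c, (hrepm x).2.const_smul c⟩
        rw [RingHom.id_apply, smul_eq_mul, ← hsmul _ _ (hrepm x)]
        refine hcongr _ (hrepm _) _ hs ?_
        exact (hrepa (c • x)).symm.trans ((Lp.coeFn_smul _ _).trans ((hrepa x).const_smul c)) }
  have hℓ : ∀ x, ‖ℓ x‖ ≤ C.toReal * ‖x‖ := by
    intro x
    have h1 := hbound _ (hrepm x)
    rw [← eLpNorm_congr_ae (hrepa x), ← Lp.enorm_def] at h1
    have h2 := ENNReal.toReal_mono (ENNReal.mul_ne_top hC enorm_ne_top) h1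
    change ‖Λ (rep x)‖ ≤ C.toReal * ‖(x : Lp ℂ 2 (volume.restrict Ω))‖
    simpa using h2
  have : CompleteSpace (bergmanSubmodule Ω) := (isClosed_bergmanSubmodule hΩ).completeSpace_coe
  let κ := (InnerProductSpace.toDual ℂ (bergmanSubmodule Ω)).symm (ℓ.mkContinuous _ hℓ)
  refine ⟨rep κ, hrepm κ, fun f hf => ?_⟩
  let x : bergmanSubmodule Ω := ⟨hf.2.toLp f, f, hf.1, hf.2.coeFn_toLp⟩
  have hx : (x : Lp ℂ 2 (volume.restrict Ω)) =ᵐ[volume.restrict Ω] f := hf.2.coeFn_toLp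
  have h1 : Λ f = ℓ x := hcongr _ hf _ (hrepm x) (hx.symm.trans (hrepa x))
  have h2 : inner ℂ κ x = ℓ x := InnerProductSpace.toDual_symm_apply
  rw [h1, ← h2, Submodule.coe_inner, L2.inner_def]
  refine integral_congr_ae ?_
  filter_upwards [hx, hrepa κ] with p h3 h4
  rw [h3, h4]
  simp [RCLike.inner_apply]

lemma exists_isReproducingAt {Ω : Set (ℂ × ℂ)} (hΩ : IsOpen Ω) {w : ℂ × ℂ} (hw : w ∈ Ω) :
    ∃ k, IsReproducingAt Ω w k := by
  obtain ⟨ε, hε, hεΩ⟩ := Metric.isOpen_iff.1 hΩ w hw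
  obtain ⟨C, hC, hCf⟩ := exists_enorm_le_eLpNorm hε
  obtain ⟨k, hk, h⟩ := exists_bergmanSpace_representer hΩ (fun f => f w)
    (fun _ _ _ _ => rfl) (fun _ _ _ => rfl) hC (fun f hf => hCf Ω f w hεΩ hf.1)
  exact ⟨k, hk, h⟩

lemma isReproducingAt_bergmanKernel {Ω : Set (ℂ × ℂ)} (hΩ : IsOpen Ω) {w : ℂ × ℂ} (hw : w ∈ Ω) :
    IsReproducingAt Ω w (fun z => bergmanKernel Ω z w) := by
  have h := exists_isReproducingAt hΩ hw
  have : (fun z => bergmanKernel Ω z w) = h.choose := by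
    funext z; rw [bergmanKernel, dif_pos h]
  rw [this]
  exact h.choose_spec

/-- A nonzero bounded functional on the Bergman space does not vanish on all kernel functions. -/
lemma exists_bergmanKernel_ne_zero {Ω : Set (ℂ × ℂ)} (hΩ : IsOpen Ω) (Λ : (ℂ × ℂ → ℂ) → ℂ)
    (hadd : ∀ f ∈ bergmanSpace Ω, ∀ g ∈ bergmanSpace Ω, Λ (f + g) = Λ f + Λ g)
    (hsmul : ∀ c : ℂ, ∀ f ∈ bergmanSpace Ω, Λ (c • f) = c * Λ f) {C : ℝ≥0∞} (hC : C ≠ ⊤)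
    (hbound : ∀ f ∈ bergmanSpace Ω, ‖Λ f‖ₑ ≤ C * eLpNorm f 2 (volume.restrict Ω))
    {f : ℂ × ℂ → ℂ} (hf : f ∈ bergmanSpace Ω) (hΛ : Λ f ≠ 0) :
    ∃ w ∈ Ω, Λ (fun z => bergmanKernel Ω z w) ≠ 0 := by
  by_contra! hcon
  obtain ⟨k, hk, hrep⟩ := exists_bergmanSpace_representer hΩ Λ hadd hsmul hC hbound
  have hk0 : ∀ w ∈ Ω, k w = 0 := by
    intro w hw
    have hK := isReproducingAt_bergmanKernel hΩ hw
    -- k(w) = ⟨k, K(·, w)⟩ is the conjugate of ⟨K(·, w), k⟩ = Λ(K(·, w)) = 0.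
    rw [hK.2 k hk, ← map_eq_zero (starRingEnd ℂ), ← integral_conj]
    rw [← hcon w hw, hrep _ hK.1]
    congr 1; funext ζ
    simp [mul_comm]
  refine hΛ ?_
  rw [hrep f hf]
  refine (setIntegral_congr_fun hΩ.measurableSet fun ζ hζ => ?_).trans (integral_zero _ _)
  simp [hk0 ζ hζ]

/-! ### Angular means as holomorphic functions of z. -/

/-- The mean of `f(z, ·)` over the circle of radius `R` about `0`. -/
noncomputable def fiberMean (f : ℂ × ℂ → ℂ) (R : ℝ) (z : ℂ) : ℂ :=
  Real.circleAverage (fun w => f (z, w)) 0 R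

/-- Differentiation under the integral, with the z-derivative dominated by a Cauchy estimate on a
compact neighbourhood of the circle. -/
lemma differentiableAt_fiberMean {Ω : Set (ℂ × ℂ)} (hΩ : IsOpen Ω) {f : ℂ × ℂ → ℂ}
    (hf : DifferentiableOn ℂ f Ω) {R : ℝ} (hR : 0 ≤ R) {z₀ : ℂ}
    (hz : ∀ w : ℂ, ‖w‖ = R → (z₀, w) ∈ Ω) : DifferentiableAt ℂ (fiberMean f R) z₀ := by
  have hK : IsCompact (({z₀} : Set ℂ) ×ˢ Metric.sphere (0 : ℂ) R) :=
    isCompact_singleton.prod (isCompact_sphere _ _)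
  obtain ⟨δ, hδ, hδΩ⟩ := hK.exists_cthickening_subset_open hΩ (by
    rintro ⟨z, w⟩ ⟨h1, h2⟩
    rw [mem_singleton_iff] at h1
    subst h1
    exact hz w (by simpa using h2))
  have hmem : ∀ z ∈ Metric.closedBall z₀ δ, ∀ w ∈ Metric.sphere (0 : ℂ) R, (z, w) ∈ Ω := by
    intro z hz w hw
    refine hδΩ (Metric.mem_cthickening_of_dist_le _ (z₀, w) _ _ ⟨rfl, hw⟩ ?_)
    rw [Prod.dist_eq]
    simpa [hδ.le] using hz
  obtain ⟨M, hM⟩ := ((isCompact_closedBall z₀ δ).prod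
    (isCompact_sphere (0 : ℂ) R)).exists_bound_of_continuousOn
    (f := f) (hf.continuousOn.mono fun p hp => hmem p.1 hp.1 p.2 hp.2)
  have hγ : ∀ θ : ℝ, circleMap 0 R θ ∈ Metric.sphere (0 : ℂ) R := circleMap_mem_sphere 0 hR
  have hdz : ∀ w ∈ Metric.sphere (0 : ℂ) R, ∀ z ∈ Metric.closedBall z₀ δ,
      DifferentiableAt ℂ (fun z => f (z, w)) z := fun w hw z hz =>
    (hf.differentiableAt (hΩ.mem_nhds (hmem z hz w hw))).comp (f := fun z => (z, w)) z
      (differentiableAt_id.prodMk (differentiableAt_const w))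
  have hcont : ∀ z ∈ Metric.closedBall z₀ δ, Continuous fun θ : ℝ => f (z, circleMap 0 R θ) := by
    intro z hz
    refine hf.continuousOn.comp_continuous (by fun_prop) fun θ => hmem z hz _ (hγ θ)
  have hz₀ : z₀ ∈ Metric.closedBall z₀ δ := Metric.mem_closedBall_self hδ.le
  have hsub : Metric.ball z₀ (δ / 2) ⊆ Metric.closedBall z₀ δ :=
    Metric.ball_subset_closedBall.trans (Metric.closedBall_subset_closedBall (by linarith))
  have key := intervalIntegral.hasDerivAt_integral_of_dominated_loc_of_deriv_le
    (μ := volume) (a := 0) (b := 2 * Real.pi) (F := fun z θ => f (z, circleMap 0 R θ))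
    (F' := fun z θ => deriv (fun z => f (z, circleMap 0 R θ)) z) (x₀ := z₀)
    (s := Metric.ball z₀ (δ / 2)) (bound := fun _ => M / (δ / 2))
    (Metric.ball_mem_nhds _ (by positivity))
    (by
      filter_upwards [Metric.ball_mem_nhds z₀ (half_pos hδ)] with z hz
      exact (hcont z (hsub hz)).aestronglyMeasurable)
    ((hcont z₀ hz₀).intervalIntegrable _ _)
    (by
      -- The derivative is measurable in θ as a pointwise limit of difference quotients along this
      -- sequence.
      have hseq : Tendsto (fun n : ℕ => z₀ + ((δ / (n + 1 : ℝ) : ℝ) : ℂ)) atTop (𝓝[≠] z₀) := by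
        refine tendsto_nhdsWithin_iff.2 ⟨?_, Eventually.of_forall fun n => ?_⟩
        · have h1 : Tendsto (fun n : ℕ => δ / (n + 1 : ℝ)) atTop (𝓝 0) := by
            simpa [div_eq_mul_inv] using
              (tendsto_one_div_add_atTop_nhds_zero_nat (𝕜 := ℝ)).const_mul δ
          have h2 := (Complex.continuous_ofReal.tendsto 0).comp h1
          simpa using h2.const_add z₀
        · have : (δ / (n + 1 : ℝ) : ℝ) ≠ 0 := by positivity
          rw [mem_compl_iff, mem_singleton_iff, add_eq_left, Complex.ofReal_eq_zero]
          exact this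
      refine aestronglyMeasurable_of_tendsto_ae atTop
        (f := fun (n : ℕ) θ => slope (fun z => f (z, circleMap 0 R θ)) z₀
          (z₀ + ((δ / (n + 1 : ℝ) : ℝ) : ℂ))) (fun n => ?_) (ae_of_all _ fun θ => ?_)
      · have hzn : z₀ + ((δ / (n + 1 : ℝ) : ℝ) : ℂ) ∈ Metric.closedBall z₀ δ := by
          have hle : δ / (n + 1 : ℝ) ≤ δ := div_le_self hδ.le (by linarith [n.cast_nonneg (α := ℝ)])
          have h0 : 0 ≤ δ / (n + 1 : ℝ) := by positivity
          rw [mem_closedBall_iff_norm, add_sub_cancel_left, Complex.norm_real,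
            Real.norm_of_nonneg h0]
          exact hle
        simp only [slope, vsub_eq_sub]
        exact (((hcont _ hzn).sub (hcont z₀ hz₀)).const_smul
          (z₀ + ((δ / (n + 1 : ℝ) : ℝ) : ℂ) - z₀)⁻¹).aestronglyMeasurable
      · exact (hasDerivAt_iff_tendsto_slope.1 (hdz _ (hγ θ) z₀ hz₀).hasDerivAt).comp hseq)
    (by
      refine ae_of_all _ fun θ _ z hz => ?_
      have hcb : Metric.closedBall z (δ / 2) ⊆ Metric.closedBall z₀ δ :=
        Metric.closedBall_subset_closedBall' (by rw [Metric.mem_ball] at hz; linarith)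
      refine Complex.norm_deriv_le_of_forall_mem_sphere_norm_le (half_pos hδ) ?_ fun ζ hζ => ?_
      · refine DifferentiableOn.diffContOnCl_ball (U := Metric.closedBall z₀ δ)
          (fun ζ hζ => (hdz _ (hγ θ) ζ hζ).differentiableWithinAt) hcb
      · exact hM (ζ, _) ⟨hcb (Metric.sphere_subset_closedBall hζ), hγ θ⟩)
    intervalIntegrable_const
    (ae_of_all _ fun θ _ z hz => (hdz _ (hγ θ) z (hsub hz)).hasDerivAt)
  exact (key.2.differentiableAt.const_smul ((2 * Real.pi)⁻¹ : ℝ) :)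

/-- The mean is the contour integral of f(z, w)/w divided by 2πi, so Cauchy's theorem on the annulus
applies. -/
lemma fiberMean_eq_of_annulus {Ω : Set (ℂ × ℂ)} (hΩ : IsOpen Ω) {f : ℂ × ℂ → ℂ}
    (hf : DifferentiableOn ℂ f Ω) {R₁ R₂ : ℝ} (h0 : 0 < R₁) (h12 : R₁ ≤ R₂) {z : ℂ}
    (hz : ∀ w : ℂ, R₁ ≤ ‖w‖ → ‖w‖ ≤ R₂ → (z, w) ∈ Ω) : fiberMean f R₂ z = fiberMean f R₁ z := by
  have hd : ∀ w : ℂ, R₁ ≤ ‖w‖ → ‖w‖ ≤ R₂ → DifferentiableAt ℂ (fun w => f (z, w)) w :=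
    fun w h1 h2 => (hf.differentiableAt (hΩ.mem_nhds (hz w h1 h2))).comp (f := fun w => (z, w)) w
      ((differentiableAt_const z).prodMk differentiableAt_id)
  unfold fiberMean
  rw [Real.circleAverage_eq_circleIntegral (by linarith),
    Real.circleAverage_eq_circleIntegral h0.ne',
    Complex.circleIntegral_sub_center_inv_smul_eq_of_differentiable_on_annulus_off_countable h0 h12
      countable_empty (fun w hw => (hd w ?_ ?_).continuousAt.continuousWithinAt) fun w hw =>
      hd w ?_ ?_]
  · simpa using hw.2
  · simpa using hw.1
  · have := hw.1.2
    rw [mem_closedBall_zero_iff, not_le] at this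
    exact this.le
  · exact (mem_ball_zero_iff.1 hw.1.1).le

/-- The angular mean of `f` over a fibre component, as a function of `z` near `0`. -/
noncomputable def fiberComponent (f : ℂ × ℂ → ℂ) (z : ℂ) : ℂ :=
  if 0 ≤ z.re then fiberMean f (√5) z else fiberMean f (√3) z

lemma mem_pinchedDomain_iff {s : ℝ} {z w : ℂ} : (z, w) ∈ pinchedDomain s ↔
    profile s ((‖w‖ ^ 2 - 3) * (‖w‖ ^ 2 - 5)) <
      1 / 100 * (‖w‖ ^ 2 - 4) * z.re + ‖z‖ ^ 2 - ‖z‖ ^ 4 := by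
  change pinchedDefFun s (z, w) < 0 ↔ _
  simp only [pinchedDefFun, Complex.normSq_eq_norm_sq]
  rw [show (‖w‖ ^ 2 - 4) ^ 2 - 1 = (‖w‖ ^ 2 - 3) * (‖w‖ ^ 2 - 5) by ring]
  constructor <;> intro h <;> nlinarith

lemma mem_pinchedDomain_of_norm_eq_sqrt_five {s : ℝ} {z w : ℂ} (hw : ‖w‖ = √5)
    (hz : ‖z‖ ^ 4 < 1 / 100 * z.re + ‖z‖ ^ 2) : (z, w) ∈ pinchedDomain s := by
  rw [mem_pinchedDomain_iff, hw, Real.sq_sqrt (by norm_num)]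
  norm_num [profile_zero]; linarith

lemma mem_pinchedDomain_of_norm_eq_sqrt_three {s : ℝ} {z w : ℂ} (hw : ‖w‖ = √3)
    (hz : ‖z‖ ^ 4 < -(1 / 100 * z.re) + ‖z‖ ^ 2) : (z, w) ∈ pinchedDomain s := by
  rw [mem_pinchedDomain_iff, hw, Real.sq_sqrt (by norm_num)]
  norm_num [profile_zero]; linarith

lemma norm_pow_four_lt {z : ℂ} (h0 : z ≠ 0) (h1 : ‖z‖ < 1) : ‖z‖ ^ 4 < ‖z‖ ^ 2 :=
  pow_lt_pow_right_of_lt_one₀ (norm_pos_iff.2 h0) h1 (by norm_num)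

/-- In this parabolic region Q ≤ 79/100, so Q - Q² ≥ 0.21 (Im z)² exceeds |Re z|/100. Hence both
circles √3 and √5 lie in the fibre, whatever the sign of Re z. -/
lemma norm_pow_four_add_lt {z : ℂ} (h0 : z.im ≠ 0) (h1 : |z.im| < 18 / 25)
    (h2 : |z.re| < z.im ^ 2) : ‖z‖ ^ 4 + 1 / 100 * |z.re| < ‖z‖ ^ 2 := by
  have hn : ‖z‖ ^ 2 = z.re ^ 2 + z.im ^ 2 := by
    rw [← Complex.normSq_eq_norm_sq, Complex.normSq_apply]; ring
  rw [show ‖z‖ ^ 4 = (‖z‖ ^ 2) ^ 2 by ring, hn]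
  have hy : z.im ^ 2 < (18 / 25) ^ 2 := by rw [← sq_abs]; gcongr
  have hy0 : 0 < z.im ^ 2 := by positivity
  have hx : z.re ^ 2 ≤ z.im ^ 2 * z.im ^ 2 := by
    rw [← sq_abs z.re, sq |z.re|]; gcongr
  have hQ : z.re ^ 2 + z.im ^ 2 ≤ 79 / 100 := by nlinarith
  nlinarith [sq_nonneg z.re, abs_nonneg z.re]

section
variable {s : ℝ} {f : ℂ × ℂ → ℂ}

lemma differentiableAt_fiberMean_sqrt_five (hs : 0 < s)
    (hf : DifferentiableOn ℂ f (pinchedDomain s)) {z : ℂ}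
    (hz : ‖z‖ ^ 4 < 1 / 100 * z.re + ‖z‖ ^ 2) : DifferentiableAt ℂ (fiberMean f (√5)) z :=
  differentiableAt_fiberMean (isOpen_pinchedDomain hs) hf (Real.sqrt_nonneg _) fun _ hw =>
    mem_pinchedDomain_of_norm_eq_sqrt_five hw hz

lemma differentiableAt_fiberMean_sqrt_three (hs : 0 < s)
    (hf : DifferentiableOn ℂ f (pinchedDomain s)) {z : ℂ}
    (hz : ‖z‖ ^ 4 < -(1 / 100 * z.re) + ‖z‖ ^ 2) : DifferentiableAt ℂ (fiberMean f (√3)) z :=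
  differentiableAt_fiberMean (isOpen_pinchedDomain hs) hf (Real.sqrt_nonneg _) fun _ hw =>
    mem_pinchedDomain_of_norm_eq_sqrt_three hw hz

/-- Between the two circles the profile is at most 3/16, and 1/5 leaves room for the mixed term. So
the whole closed annulus lies in the fibre. -/
lemma fiberMean_sqrt_five_eq_of_large (hs : 0 < s)
    (hf : DifferentiableOn ℂ f (pinchedDomain s)) {z : ℂ}
    (hz : ‖z‖ ^ 4 + 1 / 5 < ‖z‖ ^ 2) : fiberMean f (√5) z = fiberMean f (√3) z := by
  refine fiberMean_eq_of_annulus (isOpen_pinchedDomain hs) hf (by positivity)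
    (Real.sqrt_le_sqrt (by norm_num)) fun w h1 h2 => ?_
  rw [Real.sqrt_le_left (norm_nonneg _)] at h1
  rw [Real.le_sqrt (norm_nonneg _) (by norm_num)] at h2
  rw [mem_pinchedDomain_iff]
  have hE := profile_le_of_mem hs (u := (‖w‖ ^ 2 - 3) * (‖w‖ ^ 2 - 5))
    (by nlinarith [sq_nonneg (‖w‖ ^ 2 - 4)]) (by nlinarith)
  have hz1 : ‖z‖ ≤ 1 := by
    by_contra! h
    have : ‖z‖ ^ 2 ≤ ‖z‖ ^ 4 := pow_le_pow_right₀ h.le (by norm_num)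
    linarith
  have hx := abs_le.1 ((Complex.abs_re_le_norm z).trans hz1)
  nlinarith

/-- Both branches of `fiberComponent` agree near the imaginary axis, by the identity theorem. -/
lemma fiberMean_sqrt_five_eq (hs : 0 < s) (hf : DifferentiableOn ℂ f (pinchedDomain s)) {z : ℂ}
    (h0 : z.im ≠ 0) (h1 : |z.im| < 18 / 25) (h2 : |z.re| < z.im ^ 2) :
    fiberMean f (√5) z = fiberMean f (√3) z := by
  obtain ⟨e, he, hez⟩ : ∃ e : ℝ, (e = 1 ∨ e = -1) ∧ z.im = e * |z.im| := by
    rcases le_total 0 z.im with h | h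
    · exact ⟨1, Or.inl rfl, by rw [abs_of_nonneg h, one_mul]⟩
    · exact ⟨-1, Or.inr rfl, by rw [abs_of_nonpos h]; ring⟩
  have he2 : e ^ 2 = 1 := by rcases he with rfl | rfl <;> norm_num
  -- The parabolic region in one half-plane is the image of a rectangle, hence connected. It reaches
  -- from 0 to beyond ±7i/10, near which the means are known to agree.
  let γ : ℝ × ℝ → ℂ := fun q => ⟨q.1 * q.2 ^ 2, e * q.2⟩
  have hγ : Continuous γ := by
    have : γ = fun q => ((q.1 * q.2 ^ 2 : ℝ) : ℂ) + ((e * q.2 : ℝ) : ℂ) * Complex.I := by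
      funext q; exact (Complex.re_add_im (γ q)).symm
    rw [this]; fun_prop
  let O : Set ℂ := γ '' (Ioo (-1) 1 ×ˢ Ioo 0 (18 / 25))
  have hO : IsPreconnected O :=
    (((convex_Ioo _ _).prod (convex_Ioo _ _)).isPreconnected).image γ hγ.continuousOn
  have hOm : ∀ ζ ∈ O, ‖ζ‖ ^ 4 + 1 / 100 * |ζ.re| < ‖ζ‖ ^ 2 := by
    rintro _ ⟨⟨a, y⟩, ⟨⟨ha1, ha2⟩, ⟨hy1, hy2⟩⟩, rfl⟩
    simp only at ha1 ha2 hy1 hy2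
    have hee : |e| = 1 := by rcases he with rfl | rfl <;> simp
    have him : |(γ (a, y)).im| = y := by
      simp only [γ]; rw [abs_mul, hee, one_mul, abs_of_pos hy1]
    refine norm_pow_four_add_lt ?_ (him.trans_lt hy2) ?_
    · intro h; rw [h, abs_zero] at him; exact hy1.ne him
    · rw [← sq_abs (γ (a, y)).im, him]
      simp only [γ]
      rw [abs_mul, abs_of_pos (show (0 : ℝ) < y ^ 2 by positivity)]
      have : |a| < 1 := abs_lt.2 ⟨ha1, ha2⟩
      nlinarith [sq_pos_of_pos hy1]
  have hV : IsOpen {ζ : ℂ | ‖ζ‖ ^ 4 + 1 / 100 * |ζ.re| < ‖ζ‖ ^ 2} := by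
    refine isOpen_lt ?_ ?_
    · exact ((continuous_norm.pow 4).add (continuous_const.mul Complex.continuous_re.abs))
    · exact continuous_norm.pow 2
  have hA5 : AnalyticOnNhd ℂ (fiberMean f (√5)) O := by
    refine AnalyticOnNhd.mono (DifferentiableOn.analyticOnNhd (fun ζ hζ => ?_) hV) hOm
    have := neg_abs_le ζ.re
    rw [mem_ofPred_eq] at hζ
    exact (differentiableAt_fiberMean_sqrt_five hs hf (by linarith)).differentiableWithinAt
  have hA3 : AnalyticOnNhd ℂ (fiberMean f (√3)) O := by
    refine AnalyticOnNhd.mono (DifferentiableOn.analyticOnNhd (fun ζ hζ => ?_) hV) hOm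
    have := le_abs_self ζ.re
    rw [mem_ofPred_eq] at hζ
    exact (differentiableAt_fiberMean_sqrt_three hs hf (by linarith)).differentiableWithinAt
  have hpO : γ (0, 7 / 10) ∈ O := ⟨_, ⟨by norm_num, by norm_num⟩, rfl⟩
  have hnp : ‖γ (0, 7 / 10)‖ ^ 2 = 49 / 100 := by
    rw [← Complex.normSq_eq_norm_sq]
    simp only [γ, Complex.normSq_mk]
    linear_combination (49 / 100) * he2
  have hev : fiberMean f (√5) =ᶠ[𝓝 (γ (0, 7 / 10))] fiberMean f (√3) := by
    have hU : IsOpen {ζ : ℂ | ‖ζ‖ ^ 4 + 1 / 5 < ‖ζ‖ ^ 2} :=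
      isOpen_lt ((continuous_norm.pow 4).add continuous_const) (continuous_norm.pow 2)
    filter_upwards [hU.mem_nhds (by
      rw [mem_ofPred_eq, show ‖γ (0, 7 / 10)‖ ^ 4 = (‖γ (0, 7 / 10)‖ ^ 2) ^ 2 by ring, hnp]
      norm_num)] with ζ hζ using fiberMean_sqrt_five_eq_of_large hs hf hζ
  refine hA5.eqOn_of_preconnected_of_eventuallyEq hA3 hO hpO hev ?_
  have hpos : 0 < |z.im| := abs_pos.2 h0
  have hpos2 : 0 < |z.im| ^ 2 := by positivity
  rw [← sq_abs z.im, abs_lt] at h2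
  refine ⟨(z.re / |z.im| ^ 2, |z.im|), ⟨⟨?_, ?_⟩, ⟨hpos, h1⟩⟩, ?_⟩
  · rw [lt_div_iff₀ hpos2]; linarith
  · rw [div_lt_iff₀ hpos2]; linarith
  · refine Complex.ext ?_ ?_
    · simp only [γ]; field_simp
    · simp only [γ]; exact hez.symm

/-- Off the imaginary axis one branch is used locally; on it, away from 0, the two branches coincide
nearby. -/
lemma differentiableAt_fiberComponent (hs : 0 < s) (hf : DifferentiableOn ℂ f (pinchedDomain s))
    {z : ℂ} (h0 : z ≠ 0) (h1 : ‖z‖ < 18 / 25) : DifferentiableAt ℂ (fiberComponent f) z := by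
  have h4 := norm_pow_four_lt h0 (h1.trans (by norm_num))
  rcases lt_trichotomy z.re 0 with hx | hx | hx
  · refine (differentiableAt_fiberMean_sqrt_three hs hf (by linarith)).congr_of_eventuallyEq ?_
    filter_upwards [(isOpen_lt Complex.continuous_re continuous_const).mem_nhds hx] with ζ hζ
    rw [fiberComponent, if_neg (not_le.2 hζ)]
  · refine (differentiableAt_fiberMean_sqrt_five hs hf (by rw [hx]; linarith)).congr_of_eventuallyEq
      ?_
    have hy : z.im ≠ 0 := fun h => h0 (Complex.ext hx h)
    have e1 : ∀ᶠ ζ : ℂ in 𝓝 z, ζ.im ≠ 0 := (Complex.continuous_im.tendsto z).eventually_ne hy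
    have e2 : ∀ᶠ ζ : ℂ in 𝓝 z, |ζ.im| < 18 / 25 :=
      (isOpen_lt Complex.continuous_im.abs continuous_const).mem_nhds
        ((Complex.abs_im_le_norm z).trans_lt h1)
    have e3 : ∀ᶠ ζ : ℂ in 𝓝 z, |ζ.re| < ζ.im ^ 2 :=
      (isOpen_lt Complex.continuous_re.abs (Complex.continuous_im.pow 2)).mem_nhds (by
        rw [mem_ofPred_eq, hx, abs_zero]; exact sq_pos_of_ne_zero hy)
    filter_upwards [e1, e2, e3] with ζ a1 a2 a3
    rw [fiberComponent]
    split_ifs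
    · rfl
    · exact (fiberMean_sqrt_five_eq hs hf a1 a2 a3).symm
  · refine (differentiableAt_fiberMean_sqrt_five hs hf (by linarith)).congr_of_eventuallyEq ?_
    filter_upwards [(isOpen_lt continuous_const Complex.continuous_re).mem_nhds hx] with ζ hζ
    rw [fiberComponent, if_pos (le_of_lt hζ)]

end

/-! ### The residue functional. -/

/-- The residue at `z = 0` of the angular mean of `f`. -/
noncomputable def fiberResidue (f : ℂ × ℂ → ℂ) : ℂ :=
  Real.circleAverage (fun z => z * fiberComponent f z) 0 (1 / 2)

/-- The average is a Laurent coefficient, so the radius can shrink to 0, where the fibres are thin.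
-/
lemma fiberResidue_eq_circleAverage {s : ℝ} {f : ℂ × ℂ → ℂ} (hs : 0 < s)
    (hf : DifferentiableOn ℂ f (pinchedDomain s)) {r : ℝ} (h0 : 0 < r) (h1 : r ≤ 1 / 2) :
    fiberResidue f = Real.circleAverage (fun z => z * fiberComponent f z) 0 r := by
  have hd : ∀ z : ℂ, r ≤ ‖z‖ → ‖z‖ ≤ 1 / 2 →
      DifferentiableAt ℂ (fun z => z * fiberComponent f z) z := fun z h2 h3 =>
    differentiableAt_id.mul (differentiableAt_fiberComponent hs hf
      (norm_pos_iff.1 (h0.trans_le h2)) (h3.trans_lt (by norm_num)))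
  unfold fiberResidue
  rw [Real.circleAverage_eq_circleIntegral (by norm_num),
    Real.circleAverage_eq_circleIntegral h0.ne',
    Complex.circleIntegral_sub_center_inv_smul_eq_of_differentiable_on_annulus_off_countable h0 h1
      countable_empty (fun w hw => (hd w ?_ ?_).continuousAt.continuousWithinAt) fun w hw =>
      hd w ?_ ?_]
  · simpa using hw.2
  · simpa using hw.1
  · have := hw.1.2
    rw [mem_closedBall_zero_iff, not_le] at this
    exact this.le
  · exact (mem_ball_zero_iff.1 hw.1.1).le

section
variable {s : ℝ}

lemma circleIntegrable_fiber {f : ℂ × ℂ → ℂ} (hf : DifferentiableOn ℂ f (pinchedDomain s)) {R : ℝ}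
    (hR : 0 ≤ R) {z : ℂ} (hz : ∀ w : ℂ, ‖w‖ = R → (z, w) ∈ pinchedDomain s) :
    CircleIntegrable (fun w => f (z, w)) 0 R :=
  ContinuousOn.circleIntegrable hR
    (hf.continuousOn.comp (by fun_prop) fun w hw => hz w (by simpa using hw))

lemma fiberComponent_add {f g : ℂ × ℂ → ℂ}
    (hf : DifferentiableOn ℂ f (pinchedDomain s)) (hg : DifferentiableOn ℂ g (pinchedDomain s))
    {z : ℂ} (h0 : z ≠ 0) (h1 : ‖z‖ < 1) :
    fiberComponent (f + g) z = fiberComponent f z + fiberComponent g z := by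
  have h4 := norm_pow_four_lt h0 h1
  unfold fiberComponent fiberMean
  split_ifs with hx
  · have hm : ∀ w : ℂ, ‖w‖ = √5 → (z, w) ∈ pinchedDomain s := fun w hw =>
      mem_pinchedDomain_of_norm_eq_sqrt_five hw (by linarith)
    exact Real.circleAverage_add (circleIntegrable_fiber hf (Real.sqrt_nonneg _) hm)
      (circleIntegrable_fiber hg (Real.sqrt_nonneg _) hm)
  · have hm : ∀ w : ℂ, ‖w‖ = √3 → (z, w) ∈ pinchedDomain s := fun w hw =>
      mem_pinchedDomain_of_norm_eq_sqrt_three hw (by linarith)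
    exact Real.circleAverage_add (circleIntegrable_fiber hf (Real.sqrt_nonneg _) hm)
      (circleIntegrable_fiber hg (Real.sqrt_nonneg _) hm)

lemma circleIntegrable_mul_fiberComponent {f : ℂ × ℂ → ℂ} (hs : 0 < s)
    (hf : DifferentiableOn ℂ f (pinchedDomain s)) :
    CircleIntegrable (fun z => z * fiberComponent f z) 0 (1 / 2) := by
  refine ContinuousOn.circleIntegrable (by norm_num) fun z hz => ?_
  rw [mem_sphere_zero_iff_norm] at hz
  refine (continuousAt_id.mul ?_).continuousWithinAt
  refine (differentiableAt_fiberComponent hs hf ?_ (by rw [hz]; norm_num)).continuousAt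
  rw [← norm_pos_iff, hz]; norm_num

lemma fiberResidue_add {f g : ℂ × ℂ → ℂ} (hs : 0 < s)
    (hf : DifferentiableOn ℂ f (pinchedDomain s)) (hg : DifferentiableOn ℂ g (pinchedDomain s)) :
    fiberResidue (f + g) = fiberResidue f + fiberResidue g := by
  unfold fiberResidue
  rw [← Real.circleAverage_fun_add (circleIntegrable_mul_fiberComponent hs hf)
    (circleIntegrable_mul_fiberComponent hs hg)]
  refine Real.circleAverage_congr_sphere fun z hz => ?_
  rw [mem_sphere_zero_iff_norm, abs_of_pos (by norm_num)] at hz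
  rw [fiberComponent_add hf hg (by rw [← norm_pos_iff, hz]; norm_num) (by rw [hz]; norm_num),
    mul_add]

lemma fiberResidue_smul (c : ℂ) (f : ℂ × ℂ → ℂ) : fiberResidue (c • f) = c * fiberResidue f := by
  have h1 : ∀ z, fiberComponent (c • f) z = c * fiberComponent f z := by
    intro z
    unfold fiberComponent fiberMean
    split_ifs <;> exact Real.circleAverage_fun_smul (a := c) (f := fun w => f (z, w))
  unfold fiberResidue
  rw [← smul_eq_mul, ← Real.circleAverage_fun_smul]
  congr 1; funext z
  rw [h1, smul_eq_mul]; ring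

lemma enorm_circleAverage_le {f : ℂ → ℂ} {R : ℝ} (hR : 0 ≤ R) {B : ℝ≥0∞}
    (h : ∀ z : ℂ, ‖z‖ = R → ‖f z‖ₑ ≤ B) : ‖Real.circleAverage f 0 R‖ₑ ≤ B := by
  have h1 := enorm_circleAverage_mul_le f 0 R
  have h2 : ∫⁻ θ in Ioo (-Real.pi) Real.pi, ‖f (circleMap 0 R θ)‖ₑ ≤
      B * ENNReal.ofReal (2 * Real.pi) := by
    refine (lintegral_mono fun θ => h (circleMap 0 R θ) (by simp [circleMap, hR])).trans_eq ?_
    rw [setLIntegral_const, Real.volume_Ioo]; ring_nf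
  exact (ENNReal.mul_le_mul_iff_left (ENNReal.ofReal_pos.2 Real.two_pi_pos).ne'
    ENNReal.ofReal_ne_top).1 (h1.trans h2)

/-- The residue sees f only on a compact set over |z| = 1/2, where point evaluations are uniformly
bounded. -/
lemma exists_enorm_fiberResidue_le (hs : 0 < s) : ∃ C : ℝ≥0∞, C ≠ ⊤ ∧
    ∀ f : ℂ × ℂ → ℂ, DifferentiableOn ℂ f (pinchedDomain s) →
      ‖fiberResidue f‖ₑ ≤ C * eLpNorm f 2 (volume.restrict (pinchedDomain s)) := by
  let K : Set (ℂ × ℂ) :=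
    ((Metric.sphere (0 : ℂ) (1 / 2) ∩ {z | 0 ≤ z.re}) ×ˢ Metric.sphere (0 : ℂ) (√5)) ∪
    ((Metric.sphere (0 : ℂ) (1 / 2) ∩ {z | z.re ≤ 0}) ×ˢ Metric.sphere (0 : ℂ) (√3))
  have hK : IsCompact K :=
    (((isCompact_sphere _ _).inter_right (isClosed_le continuous_const Complex.continuous_re)).prod
      (isCompact_sphere _ _)).union
    (((isCompact_sphere _ _).inter_right (isClosed_le Complex.continuous_re continuous_const)).prod
      (isCompact_sphere _ _))
  have h4 : ∀ z : ℂ, ‖z‖ = 1 / 2 → ‖z‖ ^ 4 < ‖z‖ ^ 2 := fun z hz => by rw [hz]; norm_num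
  have hKΩ : K ⊆ pinchedDomain s := by
    rintro ⟨z, w⟩ (⟨⟨h1, h2⟩, h3⟩ | ⟨⟨h1, h2⟩, h3⟩)
    · simp only [mem_sphere_zero_iff_norm, mem_ofPred_eq] at h1 h2 h3
      have := h4 z h1
      exact mem_pinchedDomain_of_norm_eq_sqrt_five h3 (by linarith)
    · simp only [mem_sphere_zero_iff_norm, mem_ofPred_eq] at h1 h2 h3
      have := h4 z h1
      exact mem_pinchedDomain_of_norm_eq_sqrt_three h3 (by linarith)
  obtain ⟨δ, hδ, hδΩ⟩ := hK.exists_cthickening_subset_open (isOpen_pinchedDomain hs) hKΩ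
  obtain ⟨C, hC, hCf⟩ := exists_enorm_le_eLpNorm hδ
  refine ⟨C, hC, fun f hf => enorm_circleAverage_le (by norm_num) fun z hz => ?_⟩
  have hpt : ∀ p ∈ K, ‖f p‖ₑ ≤ C * eLpNorm f 2 (volume.restrict (pinchedDomain s)) := by
    intro p hp
    refine hCf _ f p (fun q hq => hδΩ ?_) hf
    exact Metric.mem_cthickening_of_dist_le _ p _ _ hp (Metric.mem_ball.1 hq).le
  have hle : ‖fiberComponent f z‖ₑ ≤ C * eLpNorm f 2 (volume.restrict (pinchedDomain s)) := by
    unfold fiberComponent fiberMean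
    split_ifs with hx
    · exact enorm_circleAverage_le (Real.sqrt_nonneg _) fun w hw =>
        hpt (z, w) (Or.inl ⟨⟨by simpa using hz, hx⟩, by simpa using hw⟩)
    · exact enorm_circleAverage_le (Real.sqrt_nonneg _) fun w hw =>
        hpt (z, w) (Or.inr ⟨⟨by simpa using hz, le_of_lt (not_le.1 hx)⟩, by simpa using hw⟩)
  rw [enorm_mul]
  refine (mul_le_mul' ?_ hle).trans_eq (one_mul _)
  rw [← ofReal_norm, hz]
  exact ENNReal.ofReal_le_one.2 (by norm_num)

lemma fiberResidue_inv_fst : fiberResidue (fun p => p.1⁻¹) = 1 := by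
  have h1 : ∀ z : ℂ, fiberComponent (fun p => p.1⁻¹) z = z⁻¹ := by
    intro z
    unfold fiberComponent fiberMean
    split_ifs <;> exact Real.circleAverage_const (z⁻¹ : ℂ) 0 _
  unfold fiberResidue
  simp_rw [h1]
  refine Real.circleAverage_const_on_circle fun z hz => mul_inv_cancel₀ ?_
  rw [mem_sphere_zero_iff_norm] at hz
  rw [← norm_pos_iff, hz]; norm_num

end

/-! ### Lower bound for the fibres and vanishing of the residue. -/

lemma volume_annulus {a b : ℝ} (ha : 0 ≤ a) (hab : a < b) :
    volume {w : ℂ | ‖w - 0‖ ∈ Ioo a b} = ENNReal.ofReal (Real.pi * (b ^ 2 - a ^ 2)) := by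
  have h1 : {w : ℂ | ‖w - 0‖ ∈ Ioo a b} = Metric.ball 0 b \ Metric.closedBall 0 a := by
    ext w; simp [and_comm]
  have hpi : ((NNReal.pi : NNReal) : ℝ≥0∞) = ENNReal.ofReal Real.pi := by
    rw [ENNReal.ofReal, ← NNReal.coe_real_pi, Real.toNNReal_coe]
  rw [h1, measure_sdiff (Metric.closedBall_subset_ball hab)
    Metric.isClosed_closedBall.measurableSet.nullMeasurableSet measure_closedBall_lt_top.ne,
    Complex.volume_ball, Complex.volume_closedBall, hpi, ← ENNReal.ofReal_pow (by linarith),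
    ← ENNReal.ofReal_pow ha, ← ENNReal.ofReal_mul (by positivity),
    ← ENNReal.ofReal_mul (by positivity), ← ENNReal.ofReal_sub _ (by positivity)]
  ring_nf

/-- A lower bound for the size of the fibre of `pinchedDomain s` over points of modulus `r`. -/
noncomputable def pinchWidth (s r : ℝ) : ℝ := 1 / 10 * Real.log (8 / r ^ 2) ^ (-(1 / s))

lemma five_le_log {r : ℝ} (h0 : 0 < r) (h1 : r < 1 / 10) : 5 ≤ Real.log (8 / r ^ 2) := by
  rw [Real.le_log_iff_exp_le (by positivity)]
  have h2 : Real.exp 5 = Real.exp 1 ^ 5 := by rw [← Real.exp_nat_mul]; norm_num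
  have h3 : Real.exp 1 ^ 5 ≤ 3 ^ 5 :=
    pow_le_pow_left₀ (Real.exp_pos 1).le (by linarith [Real.exp_one_lt_d9]) 5
  rw [h2, le_div_iff₀ (by positivity)]
  have : r ^ 2 ≤ (1 / 10) ^ 2 := by gcongr
  nlinarith

lemma pinchWidth_pos {s r : ℝ} (h0 : 0 < r) (h1 : r < 1 / 10) : 0 < pinchWidth s r := by
  have := five_le_log h0 h1
  unfold pinchWidth; positivity

lemma pinchWidth_le {s r : ℝ} (hs : s ∈ Ioo (0 : ℝ) 1) (h0 : 0 < r) (h1 : r < 1 / 10) :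
    pinchWidth s r ≤ 1 / 50 := by
  have hL := five_le_log h0 h1
  have h2 : Real.log (8 / r ^ 2) ^ (-(1 / s)) ≤ Real.log (8 / r ^ 2) ^ (-1 : ℝ) := by
    refine Real.rpow_le_rpow_of_exponent_le (by linarith) ?_
    have : 1 ≤ 1 / s := by rw [le_div_iff₀ hs.1]; linarith [hs.2]
    linarith
  rw [Real.rpow_neg_one] at h2
  have h3 : (Real.log (8 / r ^ 2))⁻¹ ≤ 5⁻¹ := by gcongr
  unfold pinchWidth
  linarith

/-- With L = log(8/|z|²), the condition |u| ≤ L^(-1/s) gives E ≤ 2 exp(-L) = |z|²/4, which is below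
|z|² - |z|⁴. The sign condition makes the mixed term harmless. -/
lemma mem_pinchedDomain_of_abs_le {s : ℝ} (hs : s ∈ Ioo (0 : ℝ) 1) {z w : ℂ} (h0 : z ≠ 0)
    (h1 : ‖z‖ < 1 / 10) (hsgn : 0 ≤ (‖w‖ ^ 2 - 4) * z.re)
    (hu : |(‖w‖ ^ 2 - 3) * (‖w‖ ^ 2 - 5)| ≤ 10 * pinchWidth s ‖z‖) :
    (z, w) ∈ pinchedDomain s := by
  have hr : 0 < ‖z‖ := norm_pos_iff.2 h0
  rw [mem_pinchedDomain_iff]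
  set u := (‖w‖ ^ 2 - 3) * (‖w‖ ^ 2 - 5)
  set L := Real.log (8 / ‖z‖ ^ 2) with hL
  have hL5 : 5 ≤ L := five_le_log hr h1
  have hE : profile s u ≤ ‖z‖ ^ 2 / 4 := by
    rcases eq_or_ne u 0 with h | h
    · rw [h, profile_zero]; positivity
    · have hw := pinchWidth_le hs hr h1
      refine (profile_le (by linarith) h).trans ?_
      have hup : 0 < |u| := abs_pos.2 h
      have h3 : 10 * pinchWidth s ‖z‖ = L ^ (-(1 / s)) := by unfold pinchWidth; rw [← hL]; ring
      have h4 : L ≤ |u| ^ (-s) := by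
        have h5 : (L ^ (-(1 / s))) ^ (-s) ≤ |u| ^ (-s) := by
          rw [← h3]
          exact Real.rpow_le_rpow_of_nonpos hup hu (by linarith [hs.1])
        rwa [← Real.rpow_mul (by linarith), show -(1 / s) * -s = 1 by
          field_simp [hs.1.ne'], Real.rpow_one] at h5
      have h6 : Real.exp (-(|u| ^ (-s))) ≤ Real.exp (-L) := Real.exp_le_exp.2 (by linarith)
      rw [hL, ← Real.log_inv, Real.exp_log (by positivity), inv_div] at h6
      linarith
  have h7 : ‖z‖ ^ 2 < 1 / 100 := by nlinarith
  nlinarith [sq_pos_of_pos hr]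

/-- The inner radius of the fibre annulus over `z`. -/
noncomputable def fiberRadius (z : ℂ) : ℝ := if 0 ≤ z.re then √5 else √3

lemma fiberRadius_bounds (z : ℂ) : 1 ≤ fiberRadius z ∧ fiberRadius z ≤ 9 / 4 := by
  unfold fiberRadius
  split_ifs
  · exact ⟨Real.one_le_sqrt.2 (by norm_num), Real.sqrt_le_iff.2 (by norm_num)⟩
  · exact ⟨Real.one_le_sqrt.2 (by norm_num), Real.sqrt_le_iff.2 (by norm_num)⟩

/-- Going outward from the chosen circle keeps |w|² - 4 of the right sign. The factor 1/10 in
`pinchWidth` absorbs the derivative of u with respect to |w|. -/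
lemma mem_pinchedDomain_of_fiberRadius_le {s : ℝ} (hs : s ∈ Ioo (0 : ℝ) 1) {z w : ℂ} (h0 : z ≠ 0)
    (h1 : ‖z‖ < 1 / 10) (hw : fiberRadius z ≤ ‖w‖)
    (hw' : ‖w‖ ≤ fiberRadius z + pinchWidth s ‖z‖) : (z, w) ∈ pinchedDomain s := by
  have hr : 0 < ‖z‖ := norm_pos_iff.2 h0
  have hℓ := pinchWidth_le hs hr h1
  have hℓ0 := pinchWidth_pos (s := s) hr h1
  obtain ⟨-, hb⟩ := fiberRadius_bounds z
  set ℓ := pinchWidth s ‖z‖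
  have hsq : fiberRadius z ^ 2 ≤ ‖w‖ ^ 2 := by
    have := (fiberRadius_bounds z).1
    gcongr
  have hsq' : ‖w‖ ^ 2 ≤ fiberRadius z ^ 2 + 46 / 10 * ℓ := by
    nlinarith [norm_nonneg w]
  unfold fiberRadius at hsq hsq'
  split_ifs at hsq hsq' with hx
  · rw [Real.sq_sqrt (by norm_num)] at hsq hsq'
    refine mem_pinchedDomain_of_abs_le hs h0 h1 (mul_nonneg (by linarith) hx) ?_
    rw [abs_le]; constructor <;> nlinarith
  · rw [Real.sq_sqrt (by norm_num)] at hsq hsq'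
    refine mem_pinchedDomain_of_abs_le hs h0 h1
      (mul_nonneg_of_nonpos_of_nonpos (by linarith) (not_le.1 hx).le) ?_
    rw [abs_le]; constructor <;> nlinarith

lemma fiberComponent_eq_fiberMean (f : ℂ × ℂ → ℂ) (z : ℂ) :
    fiberComponent f z = fiberMean f (fiberRadius z) z := by
  unfold fiberComponent fiberRadius; split_ifs <;> rfl

/-- The part of the fibre of `pinchedDomain s` over `z` used to estimate `fiberComponent`. -/
def fiberAnnulus (s : ℝ) (z : ℂ) : Set ℂ :=
  {w | ‖w - 0‖ ∈ Ioo (fiberRadius z) (fiberRadius z + pinchWidth s ‖z‖)}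

/-- Every circle in the annulus has the same mean, so the bound for one circle can be integrated
over the radius. -/
lemma enorm_fiberComponent_mul_le {s : ℝ} (hs : s ∈ Ioo (0 : ℝ) 1) {f : ℂ × ℂ → ℂ}
    (hf : DifferentiableOn ℂ f (pinchedDomain s)) {z : ℂ} (h0 : z ≠ 0) (h1 : ‖z‖ < 1 / 10) :
    ‖fiberComponent f z‖ₑ * volume (fiberAnnulus s z) ≤ ∫⁻ w in fiberAnnulus s z, ‖f (z, w)‖ₑ := by
  have hΩ := isOpen_pinchedDomain hs.1
  have hS : IsOpen {w : ℂ | (z, w) ∈ pinchedDomain s} := hΩ.preimage (by fun_prop)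
  have hcont : ContinuousOn (fun w => f (z, w)) {w : ℂ | (z, w) ∈ pinchedDomain s} :=
    hf.continuousOn.comp (by fun_prop) fun w hw => hw
  have hmem : ∀ w ∈ fiberAnnulus s z, (z, w) ∈ pinchedDomain s := fun w hw => by
    simp only [fiberAnnulus, sub_zero, mem_ofPred_eq] at hw
    exact mem_pinchedDomain_of_fiberRadius_le hs h0 h1 hw.1.le hw.2.le
  have hR1 := (fiberRadius_bounds z).1
  have key := enorm_mul_volume_le_of_circle_le (c := 0)
    (A := Ioo (fiberRadius z) (fiberRadius z + pinchWidth s ‖z‖)) measurableSet_Ioo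
    (a := ‖fiberComponent f z‖ₑ)
    (H := {w : ℂ | (z, w) ∈ pinchedDomain s}.indicator fun w => ‖f (z, w)‖ₑ)
    (hcont.measurable_indicator_enorm hS.measurableSet) (by
      intro r hr hr0
      have hin : ∀ w : ℂ, fiberRadius z ≤ ‖w‖ → ‖w‖ ≤ r → (z, w) ∈ pinchedDomain s :=
        fun w h2 h3 => mem_pinchedDomain_of_fiberRadius_le hs h0 h1 h2 (h3.trans hr.2.le)
      rw [fiberComponent_eq_fiberMean, ← fiberMean_eq_of_annulus hΩ hf (by linarith) hr.1.le hin]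
      refine (enorm_circleAverage_mul_le _ 0 r).trans_eq (lintegral_congr fun θ => ?_)
      have hn : ‖circleMap 0 r θ‖ = r := by simp [circleMap, abs_of_pos hr0]
      rw [indicator_of_mem]
      exact hin _ (by rw [hn]; exact hr.1.le) hn.le)
  refine key.trans_eq (setLIntegral_congr_fun ?_ fun w hw =>
    indicator_of_mem (show w ∈ {w : ℂ | (z, w) ∈ pinchedDomain s} from hmem w hw) _)
  exact (by fun_prop : Measurable fun w : ℂ => ‖w - 0‖) measurableSet_Ioo

lemma measurableSet_fiberAnnulus (s : ℝ) (z : ℂ) : MeasurableSet (fiberAnnulus s z) :=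
  (by fun_prop : Measurable fun w : ℂ => ‖w - 0‖) measurableSet_Ioo

lemma volume_fiberAnnulus {s : ℝ} {z : ℂ} (h0 : z ≠ 0) (h1 : ‖z‖ < 1 / 10) :
    ENNReal.ofReal (pinchWidth s ‖z‖) ≤ volume (fiberAnnulus s z) ∧
      volume (fiberAnnulus s z) ≠ ⊤ := by
  have hℓ0 := pinchWidth_pos (s := s) (norm_pos_iff.2 h0) h1
  obtain ⟨hR1, -⟩ := fiberRadius_bounds z
  have h := volume_annulus (a := fiberRadius z) (b := fiberRadius z + pinchWidth s ‖z‖)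
    (by linarith) (by linarith)
  rw [fiberAnnulus, h]
  refine ⟨ENNReal.ofReal_le_ofReal ?_, ENNReal.ofReal_ne_top⟩
  have := Real.pi_gt_three
  have h2 : pinchWidth s ‖z‖ ≤ (fiberRadius z + pinchWidth s ‖z‖) ^ 2 - fiberRadius z ^ 2 := by
    nlinarith
  nlinarith

/-- Splitting at level M: below it a ≤ M, above it a² log^q a is at least a M log^q M. -/
lemma le_add_mul_posLog_rpow {a M q : ℝ} (ha : 0 ≤ a) (hM : 1 < M) (hq : 0 < q) :
    a ≤ M + 1 / (M * Real.log M ^ q) * (a ^ 2 * Real.posLog a ^ q) := by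
  have hlog : 0 < Real.log M := Real.log_pos hM
  have hq0 : 0 < Real.log M ^ q := Real.rpow_pos_of_pos hlog q
  have hp : 0 ≤ Real.posLog a ^ q := Real.rpow_nonneg Real.posLog_nonneg q
  rcases le_or_gt a M with h | h
  · have : 0 ≤ 1 / (M * Real.log M ^ q) * (a ^ 2 * Real.posLog a ^ q) := by positivity
    linarith
  · have h1 : Real.log M ^ q ≤ Real.posLog a ^ q := by
      refine Real.rpow_le_rpow hlog.le ?_ hq.le
      exact (Real.log_le_log (by linarith) h.le).trans (le_max_right _ _)
    have h2 : a * (M * Real.log M ^ q) ≤ a ^ 2 * Real.posLog a ^ q := by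
      calc a * (M * Real.log M ^ q) ≤ a * (a * Real.posLog a ^ q) := by gcongr
        _ = _ := by ring
    have h3 : a ≤ 1 / (M * Real.log M ^ q) * (a ^ 2 * Real.posLog a ^ q) := by
      rw [one_div, ← div_eq_inv_mul, le_div_iff₀ (by positivity)]; exact h2
    linarith

/-- The threshold enters here: (log 1/r)^(q - 1/s) is at least of order (log 1/r)^(-1) because q ≥
1/s - 1. -/
lemma exists_le_pinchWidth_mul_log {s q ε : ℝ} (hs : s ∈ Ioo (0 : ℝ) 1) (hq : 1 / s - 1 ≤ q)
    (hε : 0 < ε) : ∃ r₁ c : ℝ, 0 < r₁ ∧ r₁ ≤ 1 / 10 ∧ 0 < c ∧ ∀ r ∈ Ioo 0 r₁, 1 < ε / r ∧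
      c * (r * Real.log (8 / r ^ 2))⁻¹ ≤ pinchWidth s r * Real.log (ε / r) ^ q / r := by
  have hq0 : 0 < q := by
    have : 1 < 1 / s := by rw [lt_div_iff₀ hs.1]; linarith [hs.2]
    linarith
  -- The bounds give, in turn, log(8/r²) ≥ 5, ε/r > 1 and log(ε/r) ≥ log(8/r²)/4.
  refine ⟨min (1 / 10) (min (ε / 2) (Real.exp (2 * Real.log ε - Real.log 8 / 2))),
    1 / 10 * (1 / 4) ^ q, by positivity, min_le_left _ _, by positivity, ?_⟩
  rintro r ⟨h0, hr⟩
  rw [lt_min_iff, lt_min_iff] at hr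
  obtain ⟨hr1, hr2, hr3⟩ := hr
  have hL5 := five_le_log h0 hr1
  refine ⟨by rw [lt_div_iff₀ h0]; linarith, ?_⟩
  have hlr : Real.log r ≤ 2 * Real.log ε - Real.log 8 / 2 := by
    rw [Real.log_le_iff_le_exp h0]; exact hr3.le
  have hLe : Real.log (8 / r ^ 2) = Real.log 8 - 2 * Real.log r := by
    rw [Real.log_div (by norm_num) (by positivity), Real.log_pow]; norm_num
  have hεr : Real.log (ε / r) = Real.log ε - Real.log r := Real.log_div hε.ne' h0.ne'
  unfold pinchWidth
  set L := Real.log (8 / r ^ 2)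
  have h4 : 1 / 4 * L ≤ Real.log (ε / r) := by rw [hεr, hLe]; linarith
  have h5 : (1 / 4) ^ q * L ^ q ≤ Real.log (ε / r) ^ q := by
    rw [← Real.mul_rpow (by norm_num) (by linarith)]
    exact Real.rpow_le_rpow (by positivity) h4 hq0.le
  have h6 : L⁻¹ ≤ L ^ (-(1 / s)) * L ^ q := by
    rw [← Real.rpow_add (by linarith), ← Real.rpow_neg_one]
    exact Real.rpow_le_rpow_of_exponent_le (by linarith) (by linarith)
  rw [mul_inv, le_div_iff₀ h0]
  have hL0 : 0 < L := by linarith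
  calc 1 / 10 * (1 / 4) ^ q * (r⁻¹ * L⁻¹) * r = 1 / 10 * (1 / 4) ^ q * L⁻¹ := by field_simp
    _ ≤ 1 / 10 * (1 / 4) ^ q * (L ^ (-(1 / s)) * L ^ q) := by gcongr
    _ = 1 / 10 * L ^ (-(1 / s)) * ((1 / 4) ^ q * L ^ q) := by ring
    _ ≤ _ := by gcongr

/-- The integrand has an antiderivative that is a multiple of log log(8/r²), which is unbounded at
0. -/
lemma lintegral_inv_mul_log_eq_top {r₁ c : ℝ} (h0 : 0 < r₁) (h1 : r₁ ≤ 1 / 10) (hc : 0 < c) :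
    ∫⁻ r in Ioo 0 r₁, ENNReal.ofReal (c * (r * Real.log (8 / r ^ 2))⁻¹) = ⊤ := by
  have hL5 : ∀ r ∈ Ioo 0 r₁, 5 ≤ Real.log (8 / r ^ 2) := fun r hr =>
    five_le_log hr.1 (hr.2.trans_le h1)
  by_contra hne
  have hmeas : AEStronglyMeasurable (fun r : ℝ => c * (r * Real.log (8 / r ^ 2))⁻¹)
      (volume.restrict (Ioo 0 r₁)) := by
    have : Measurable fun r : ℝ => c * (r * Real.log (8 / r ^ 2))⁻¹ := by fun_prop
    exact this.aestronglyMeasurable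
  have hint : IntegrableOn (fun r : ℝ => c * (r * Real.log (8 / r ^ 2))⁻¹) (Ioo 0 r₁) := by
    refine (lintegral_ofReal_ne_top_iff_integrable hmeas ?_).1 hne
    filter_upwards [ae_restrict_mem measurableSet_Ioo] with r hr
    have := hL5 r hr
    have := hr.1
    simp only [Pi.zero_apply]
    positivity
  have hLe : ∀ r : ℝ, 0 < r → Real.log (8 / r ^ 2) = Real.log 8 - 2 * Real.log r := fun r hr => by
    rw [Real.log_div (by norm_num) (by positivity), Real.log_pow]; norm_num
  have hev : ∀ᶠ r : ℝ in 𝓝[>] 0, r ∈ Ioo 0 r₁ := Ioo_mem_nhdsGT h0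
  have hder : ∀ r ∈ Ioo 0 r₁, HasDerivAt (fun r : ℝ => Real.log (Real.log 8 - 2 * Real.log r))
      (-2 * (r * Real.log (8 / r ^ 2))⁻¹) r := by
    intro r hr
    have hr0 := hr.1
    have h5 := hL5 r hr
    rw [hLe r hr0] at h5 ⊢
    have h := (((Real.hasDerivAt_log hr0.ne').const_mul 2).const_sub (Real.log 8)).log
      (by linarith)
    refine h.congr_deriv ?_
    rw [mul_inv]; ring
  refine not_integrableOn_of_tendsto_norm_atTop_of_deriv_isBigO_filter (𝓝[>] (0 : ℝ))
    (f := fun r : ℝ => Real.log (Real.log 8 - 2 * Real.log r)) (Ioo_mem_nhdsGT h0)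
    (hev.mono fun r hr => (hder r hr).differentiableAt) ?_ ?_ hint
  · refine tendsto_norm_atTop_atTop.comp (Real.tendsto_log_atTop.comp ?_)
    exact tendsto_atTop_add_const_left _ _ (tendsto_neg_atBot_atTop.comp
      (Real.tendsto_log_nhdsGT_zero.const_mul_atBot (by norm_num : (0 : ℝ) < 2)))
  · refine Asymptotics.IsBigO.of_bound (2 / c) (hev.mono fun r hr => ?_)
    rw [(hder r hr).deriv, norm_mul, norm_mul, Real.norm_of_nonneg hc.le]
    norm_num
    field_simp
    exact le_rfl

/-- The integrand of `bergmanLogSpace`, extended by zero. -/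
noncomputable def logIntegrand (q : ℝ) (Ω : Set (ℂ × ℂ)) (f : ℂ × ℂ → ℂ) : ℂ × ℂ → ℝ≥0∞ :=
  Ω.indicator fun ζ => ENNReal.ofReal (‖f ζ‖ ^ 2 * Real.posLog ‖f ζ‖ ^ q)

lemma measurable_logIntegrand {q : ℝ} (hq : 0 < q) {Ω : Set (ℂ × ℂ)} (hΩ : IsOpen Ω)
    {f : ℂ × ℂ → ℂ} (hf : ContinuousOn f Ω) : Measurable (logIntegrand q Ω f) := by
  classical
  unfold logIntegrand
  rw [← piecewise_eq_indicator]
  refine ContinuousOn.measurable_piecewise ?_ continuous_zero.continuousOn hΩ.measurableSet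
  refine ENNReal.continuous_ofReal.comp_continuousOn ?_
  refine (hf.norm.pow 2).mul (ContinuousOn.rpow_const ?_ fun _ _ => Or.inr hq.le)
  exact Real.continuous_posLog.comp_continuousOn hf.norm

lemma enorm_fiberComponent_le {s q M : ℝ} (hs : s ∈ Ioo (0 : ℝ) 1) (hq : 0 < q) (hM : 1 < M)
    {f : ℂ × ℂ → ℂ} (hf : DifferentiableOn ℂ f (pinchedDomain s)) {z : ℂ} (h0 : z ≠ 0)
    (h1 : ‖z‖ < 1 / 10) :
    ‖fiberComponent f z‖ₑ ≤ ENNReal.ofReal M +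
      ENNReal.ofReal (1 / (M * Real.log M ^ q) / pinchWidth s ‖z‖) *
        ∫⁻ w, logIntegrand q (pinchedDomain s) f (z, w) := by
  obtain ⟨hV1, hV2⟩ := volume_fiberAnnulus (s := s) h0 h1
  have hℓ := pinchWidth_pos (s := s) (norm_pos_iff.2 h0) h1
  have hV0 : volume (fiberAnnulus s z) ≠ 0 :=
    (lt_of_lt_of_le (ENNReal.ofReal_pos.2 hℓ) hV1).ne'
  have hlog : 0 < Real.log M := Real.log_pos hM
  have hk : 0 ≤ 1 / (M * Real.log M ^ q) := by positivity
  set k := 1 / (M * Real.log M ^ q)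
  set Φ := ∫⁻ w, logIntegrand q (pinchedDomain s) f (z, w)
  have hbound : ∫⁻ w in fiberAnnulus s z, ‖f (z, w)‖ₑ ≤
      ENNReal.ofReal M * volume (fiberAnnulus s z) + ENNReal.ofReal k * Φ := by
    have hm : Measurable fun w => logIntegrand q (pinchedDomain s) f (z, w) :=
      (measurable_logIntegrand hq (isOpen_pinchedDomain hs.1) hf.continuousOn).comp (by fun_prop)
    calc ∫⁻ w in fiberAnnulus s z, ‖f (z, w)‖ₑ
        ≤ ∫⁻ w in fiberAnnulus s z, (ENNReal.ofReal M +
          ENNReal.ofReal k * logIntegrand q (pinchedDomain s) f (z, w)) := by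
          refine setLIntegral_mono' (measurableSet_fiberAnnulus s z) fun w hw => ?_
          simp only [fiberAnnulus, sub_zero, mem_ofPred_eq] at hw
          have hw' := mem_pinchedDomain_of_fiberRadius_le hs h0 h1 hw.1.le hw.2.le
          rw [logIntegrand, indicator_of_mem hw', ← ofReal_norm, ← ENNReal.ofReal_mul hk,
            ← ENNReal.ofReal_add (by linarith) (mul_nonneg hk (mul_nonneg (sq_nonneg _)
              (Real.rpow_nonneg Real.posLog_nonneg q)))]
          exact ENNReal.ofReal_le_ofReal (le_add_mul_posLog_rpow (norm_nonneg _) hM hq)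
      _ = ENNReal.ofReal M * volume (fiberAnnulus s z) + ENNReal.ofReal k *
          ∫⁻ w in fiberAnnulus s z, logIntegrand q (pinchedDomain s) f (z, w) := by
          rw [lintegral_add_left measurable_const, setLIntegral_const, lintegral_const_mul _ hm]
      _ ≤ _ := by gcongr; exact setLIntegral_le_lintegral _ _
  have h2 := (enorm_fiberComponent_mul_le hs hf h0 h1).trans hbound
  rw [ENNReal.ofReal_div_of_pos hℓ]
  rw [← ENNReal.le_div_iff_mul_le (Or.inl hV0) (Or.inl hV2), ENNReal.add_div,
    ENNReal.mul_div_cancel_right hV0 hV2] at h2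
  refine h2.trans ?_
  gcongr ENNReal.ofReal M + ?_
  calc ENNReal.ofReal k * Φ / volume (fiberAnnulus s z)
      ≤ ENNReal.ofReal k * Φ / ENNReal.ofReal (pinchWidth s ‖z‖) := by gcongr
    _ = _ := by rw [div_eq_mul_inv, div_eq_mul_inv]; ring

/-- Functions in `A²(log A)^q` have no residue. -/
lemma fiberResidue_eq_zero {s q : ℝ} (hs : s ∈ Ioo (0 : ℝ) 1) (hq : 1 / s - 1 ≤ q)
    {f : ℂ × ℂ → ℂ} (hf : f ∈ bergmanLogSpace q (pinchedDomain s)) : fiberResidue f = 0 := by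
  obtain ⟨hf, hfin⟩ := hf
  by_contra hne
  have hq0 : 0 < q := by
    have : 1 < 1 / s := by rw [lt_div_iff₀ hs.1]; linarith [hs.2]
    linarith
  have hΩ := isOpen_pinchedDomain hs.1
  set ε := ‖fiberResidue f‖ / 2 with hεd
  have hε : 0 < ε := by have := norm_pos_iff.2 hne; positivity
  obtain ⟨r₁, c, hr₁, hr₁', hc, hrc⟩ := exists_le_pinchWidth_mul_log hs hq hε
  set Ψ := logIntegrand q (pinchedDomain s) f with hΨ
  have hΨm : Measurable Ψ := measurable_logIntegrand hq0 hΩ hf.continuousOn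
  have hΦm : Measurable fun z : ℂ => ∫⁻ w, Ψ (z, w) := hΨm.lintegral_prod_right'
  have hmain : ∀ r ∈ Ioo 0 r₁,
      ENNReal.ofReal (2 * Real.pi * ε ^ 2 * c * (r * Real.log (8 / r ^ 2))⁻¹) ≤
      ENNReal.ofReal r * ∫⁻ θ in Ioo (-Real.pi) Real.pi, ∫⁻ w, Ψ (circleMap 0 r θ, w) := by
    intro r hr
    obtain ⟨hM, hle⟩ := hrc r hr
    have hr0 := hr.1
    have hr10 : r < 1 / 10 := hr.2.trans_le hr₁'
    have hℓ := pinchWidth_pos (s := s) hr0 hr10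
    have hlogq : 0 < Real.log (ε / r) ^ q := Real.rpow_pos_of_pos (Real.log_pos hM) q
    set J := ∫⁻ θ in Ioo (-Real.pi) Real.pi, ∫⁻ w, Ψ (circleMap 0 r θ, w) with hJ
    set k := r * (1 / (ε / r * Real.log (ε / r) ^ q) / pinchWidth s r) with hk
    have hk0 : 0 < k := by positivity
    -- The residue has modulus 2ε. Taking the level M = ε/r makes the bounded part of f contribute
    -- at most ε, so the other half must come from the weighted integral.
    have h1 : ENNReal.ofReal (2 * ε) * ENNReal.ofReal (2 * Real.pi) ≤
        ENNReal.ofReal ε * ENNReal.ofReal (2 * Real.pi) + ENNReal.ofReal k * J := by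
      have e1 : ENNReal.ofReal (2 * ε) = ‖fiberResidue f‖ₑ := by
        rw [← ofReal_norm, hεd]; congr 1; ring
      rw [e1, fiberResidue_eq_circleAverage hs.1 hf hr0 (by linarith)]
      refine (enorm_circleAverage_mul_le _ 0 r).trans ?_
      calc ∫⁻ θ in Ioo (-Real.pi) Real.pi,
            ‖circleMap 0 r θ * fiberComponent f (circleMap 0 r θ)‖ₑ
          ≤ ∫⁻ θ in Ioo (-Real.pi) Real.pi,
            (ENNReal.ofReal ε + ENNReal.ofReal k * ∫⁻ w, Ψ (circleMap 0 r θ, w)) := by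
            refine lintegral_mono fun θ => ?_
            have hn : ‖circleMap 0 r θ‖ = r := by simp [circleMap, abs_of_pos hr0]
            have h0 : circleMap 0 r θ ≠ 0 := by rw [← norm_pos_iff, hn]; exact hr0
            have h2 := enorm_fiberComponent_le hs hq0 hM hf h0 (by rw [hn]; exact hr10)
            rw [hn] at h2
            rw [enorm_mul, ← ofReal_norm (circleMap 0 r θ), hn]
            refine (mul_le_mul' le_rfl h2).trans_eq ?_
            rw [mul_add, ← mul_assoc, ← ENNReal.ofReal_mul hr0.le, ← ENNReal.ofReal_mul hr0.le,
              mul_div_cancel₀ _ hr0.ne']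
        _ = _ := by
            have hm2 : Measurable fun θ : ℝ => ∫⁻ w, Ψ (circleMap 0 r θ, w) :=
              hΦm.comp (continuous_circleMap 0 r).measurable
            rw [lintegral_add_left measurable_const, setLIntegral_const, lintegral_const_mul _ hm2,
              Real.volume_Ioo, ← hJ]
            ring_nf
    have h2 : ENNReal.ofReal (2 * Real.pi * ε) ≤ ENNReal.ofReal k * J := by
      rw [← ENNReal.ofReal_mul (by positivity), ← ENNReal.ofReal_mul hε.le] at h1
      have e2 : 2 * ε * (2 * Real.pi) = ε * (2 * Real.pi) + 2 * Real.pi * ε := by ring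
      have hpi := Real.pi_pos
      rw [e2, ENNReal.ofReal_add (by positivity) (by positivity)] at h1
      exact (ENNReal.add_le_add_iff_left ENNReal.ofReal_ne_top).1 h1
    have h3 : ENNReal.ofReal (2 * Real.pi * ε ^ 2 * c * (r * Real.log (8 / r ^ 2))⁻¹) ≤
        ENNReal.ofReal (r / k) * ENNReal.ofReal (2 * Real.pi * ε) := by
      have hpi := Real.pi_pos
      rw [← ENNReal.ofReal_mul (by positivity)]
      refine ENNReal.ofReal_le_ofReal ?_
      have e3 : r / k * (2 * Real.pi * ε) =
          2 * Real.pi * ε ^ 2 * (pinchWidth s r * Real.log (ε / r) ^ q / r) := by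
        rw [hk]; field_simp
      rw [e3, mul_assoc]
      gcongr
    refine h3.trans ((mul_le_mul' le_rfl h2).trans_eq ?_)
    rw [← mul_assoc, ← ENNReal.ofReal_mul (by positivity), div_mul_cancel₀ _ hk0.ne']
  -- Integrating the bounds `hmain` over r gives a divergent lower bound.
  have htop : ∫⁻ ζ, Ψ ζ = ⊤ := by
    rw [Measure.volume_eq_prod, lintegral_prod _ hΨm.aemeasurable,
      lintegral_eq_lintegral_circleMap 0 hΦm, ← top_le_iff,
      ← lintegral_inv_mul_log_eq_top hr₁ hr₁' (c := 2 * Real.pi * ε ^ 2 * c)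
        (by have := Real.pi_pos; positivity)]
    refine (setLIntegral_mono' measurableSet_Ioo hmain).trans ?_
    exact lintegral_mono_set Ioo_subset_Ioi_self
  rw [hΨ, logIntegrand, lintegral_indicator hΩ.measurableSet] at htop
  exact hfin.ne htop

/-! ### Upper bound for the fibres and square integrability of 1/z. -/

/-- An upper bound for the size of the fibre of `pinchedDomain s` over points of modulus `r`. -/
noncomputable def pinchBound (s r : ℝ) : ℝ := Real.log (1 / (4 * r)) ^ (-(1 / s))

lemma one_le_log_inv {r : ℝ} (h0 : 0 < r) (h1 : r ≤ 1 / 16) : 1 ≤ Real.log (1 / (4 * r)) := by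
  rw [Real.le_log_iff_exp_le (by positivity), le_div_iff₀ (by positivity)]
  nlinarith [Real.exp_one_lt_d9]

/-- If |u| were larger, then E ≥ exp(-|u|^(-s))/2 ≥ 2|z|, more than the mixed term and |z|² allow.
That the threshold is of order |z|, not |z|² as in the lower bound, does not matter inside a
logarithm. -/
lemma abs_lt_pinchBound {s : ℝ} (hs : 0 < s) {z w : ℂ} (h0 : z ≠ 0) (h1 : ‖z‖ ≤ 1 / 16)
    (h : (z, w) ∈ pinchedDomain s) :
    |(‖w‖ ^ 2 - 3) * (‖w‖ ^ 2 - 5)| < pinchBound s ‖z‖ := by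
  have hr : 0 < ‖z‖ := norm_pos_iff.2 h0
  have hM := one_le_log_inv hr h1
  have ht := (bounds_of_pinchedDefFun_nonpos hs (le_of_lt h)).1
  rw [Complex.normSq_eq_norm_sq] at ht
  simp only at ht
  rw [mem_pinchedDomain_iff] at h
  unfold pinchBound
  set u := (‖w‖ ^ 2 - 3) * (‖w‖ ^ 2 - 5)
  set M := Real.log (1 / (4 * ‖z‖)) with hMd
  by_contra! hcon
  have hδ : 0 < M ^ (-(1 / s)) := by positivity
  have hu : u ≠ 0 := by
    intro hu; rw [hu, abs_zero] at hcon; linarith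
  have h2 := (le_profile (s := s) hu).trans_lt h
  have h3 : |u| ^ (-s) ≤ M := by
    have h4 := Real.rpow_le_rpow_of_nonpos hδ hcon (show -s ≤ 0 by linarith)
    rwa [← Real.rpow_mul (by linarith), show -(1 / s) * -s = 1 by field_simp, Real.rpow_one] at h4
  have h5 : 4 * ‖z‖ ≤ Real.exp (-(|u| ^ (-s))) := by
    have : Real.exp (-M) ≤ Real.exp (-(|u| ^ (-s))) := Real.exp_le_exp.2 (by linarith)
    rwa [hMd, ← Real.log_inv, Real.exp_log (by positivity), one_div, inv_inv] at this
  have h6 : (‖w‖ ^ 2 - 4) * z.re ≤ 2 * ‖z‖ := by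
    have ha : |‖w‖ ^ 2 - 4| ≤ 2 := abs_le_of_sq_le_sq (by linarith) (by norm_num)
    refine (le_abs_self _).trans ?_
    rw [abs_mul]
    exact mul_le_mul ha (Complex.abs_re_le_norm z) (abs_nonneg _) (by norm_num)
  have h7 : 0 ≤ ‖z‖ ^ 4 := by positivity
  nlinarith

/-- One of the two factors of u has modulus at least 1, so the other is below `pinchBound`. This
puts w in an annulus about √3 or √5. -/
lemma volume_fiber_le {s : ℝ} (hs : 0 < s) {z : ℂ} (h0 : z ≠ 0) (h1 : ‖z‖ ≤ 1 / 16) :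
    volume {w : ℂ | (z, w) ∈ pinchedDomain s} ≤ ENNReal.ofReal (60 * pinchBound s ‖z‖) := by
  have hM := one_le_log_inv (norm_pos_iff.2 h0) h1
  have hδ0 : 0 < pinchBound s ‖z‖ := by unfold pinchBound; positivity
  have hδ1 : pinchBound s ‖z‖ ≤ 1 :=
    Real.rpow_le_one_of_one_le_of_nonpos hM (neg_nonpos.2 (by positivity))
  have hsub : {w : ℂ | (z, w) ∈ pinchedDomain s} ⊆
      {w : ℂ | ‖w - 0‖ ∈ Ioo (√3 - pinchBound s ‖z‖) (√3 + pinchBound s ‖z‖)} ∪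
      {w : ℂ | ‖w - 0‖ ∈ Ioo (√5 - pinchBound s ‖z‖) (√5 + pinchBound s ‖z‖)} := by
    intro w hw
    have hu := abs_lt_pinchBound hs h0 h1 hw
    set δ := pinchBound s ‖z‖
    have hcl : ∀ a : ℝ, 1 ≤ a → |‖w‖ ^ 2 - a ^ 2| < δ →
        ‖w - 0‖ ∈ Ioo (a - δ) (a + δ) := by
      intro a ha h2
      have h3 : |‖w‖ - a| < δ := by
        refine lt_of_le_of_lt ?_ h2
        rw [show ‖w‖ ^ 2 - a ^ 2 = (‖w‖ - a) * (‖w‖ + a) by ring, abs_mul]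
        refine le_mul_of_one_le_right (abs_nonneg _) ?_
        rw [abs_of_nonneg (by positivity)]
        linarith [norm_nonneg w]
      rw [sub_zero]
      obtain ⟨h4, h5⟩ := abs_lt.1 h3
      exact ⟨by linarith, by linarith⟩
    rw [abs_mul] at hu
    rcases le_total 4 (‖w‖ ^ 2) with h | h
    · right
      refine hcl _ (Real.one_le_sqrt.2 (by norm_num)) ?_
      rw [Real.sq_sqrt (by norm_num)]
      refine lt_of_le_of_lt (le_mul_of_one_le_left (abs_nonneg _) ?_) hu
      exact (by linarith : 1 ≤ ‖w‖ ^ 2 - 3).trans (le_abs_self _)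
    · left
      refine hcl _ (Real.one_le_sqrt.2 (by norm_num)) ?_
      rw [Real.sq_sqrt (by norm_num)]
      refine lt_of_le_of_lt (le_mul_of_one_le_right (abs_nonneg _) ?_) hu
      exact (by linarith : 1 ≤ -(‖w‖ ^ 2 - 5)).trans (neg_le_abs _)
  have hvol : ∀ a : ℝ, 1 ≤ a → a ≤ 9 / 4 →
      volume {w : ℂ | ‖w - 0‖ ∈ Ioo (a - pinchBound s ‖z‖) (a + pinchBound s ‖z‖)} ≤
        ENNReal.ofReal (30 * pinchBound s ‖z‖) := by
    intro a ha1 ha2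
    rw [volume_annulus (by linarith) (by linarith)]
    refine ENNReal.ofReal_le_ofReal ?_
    have hpi := Real.pi_lt_d2
    have hpi0 := Real.pi_pos
    have e : Real.pi * ((a + pinchBound s ‖z‖) ^ 2 - (a - pinchBound s ‖z‖) ^ 2) =
        4 * (Real.pi * a) * pinchBound s ‖z‖ := by ring
    rw [e]
    gcongr
    nlinarith
  refine (measure_mono hsub).trans ((measure_union_le _ _).trans ?_)
  rw [show 60 * pinchBound s ‖z‖ = 30 * pinchBound s ‖z‖ + 30 * pinchBound s ‖z‖ by ring,
    ENNReal.ofReal_add (by positivity) (by positivity)]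
  exact add_le_add
    (hvol _ (Real.one_le_sqrt.2 (by norm_num)) (Real.sqrt_le_iff.2 (by norm_num)))
    (hvol _ (Real.one_le_sqrt.2 (by norm_num)) (Real.sqrt_le_iff.2 (by norm_num)))

/-- An antiderivative is a multiple of log(1/(4r))^(1 - 1/s), which tends to 0 at the origin because
s < 1. -/
lemma integrableOn_pinchBound_div {s : ℝ} (hs : s ∈ Ioo (0 : ℝ) 1) :
    IntegrableOn (fun r => pinchBound s r / r) (Ioc 0 (1 / 16)) := by
  have hexp : 0 < 1 / s - 1 := by
    have : 1 < 1 / s := by rw [lt_div_iff₀ hs.1]; linarith [hs.2]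
    linarith
  have hcl : ∀ r : ℝ, 0 < r → Real.log (1 / (4 * r)) = -Real.log 4 - Real.log r := fun r hr => by
    rw [one_div, Real.log_inv, Real.log_mul (by norm_num) hr.ne']; ring
  have hder : ∀ r ∈ Ioo (0 : ℝ) (1 / 16), HasDerivAt
      (fun r => Real.log (1 / (4 * r)) ^ (-(1 / s - 1)))
      ((1 / s - 1) * (pinchBound s r / r)) r := by
    intro r hr
    have hM := one_le_log_inv hr.1 hr.2.le
    have h1 : HasDerivAt (fun r => Real.log (1 / (4 * r))) (-r⁻¹) r := by
      refine ((Real.hasDerivAt_log hr.1.ne').const_sub (-Real.log 4)).congr_of_eventuallyEq ?_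
      filter_upwards [Ioi_mem_nhds hr.1] with v hv using hcl v hv
    refine (h1.rpow_const (p := -(1 / s - 1)) (Or.inl (by linarith))).congr_deriv ?_
    unfold pinchBound
    rw [show -(1 / s - 1) - 1 = -(1 / s) by ring]
    ring
  have hint : IntegrableOn (fun r => (1 / s - 1) * (pinchBound s r / r)) (Ioc 0 (1 / 16)) := by
    refine intervalIntegral.integrableOn_deriv_of_nonneg
      (g := fun r => Real.log (1 / (4 * r)) ^ (-(1 / s - 1))) ?_ hder ?_
    · intro r hr
      rcases hr.1.eq_or_lt with rfl | h0
      · refine ContinuousWithinAt.mono ?_ Icc_subset_Ici_self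
        rw [← continuousWithinAt_Ioi_iff_Ici]
        have h1 : Tendsto (fun r : ℝ => Real.log (1 / (4 * r))) (𝓝[>] 0) atTop := by
          have h2 : Tendsto (fun r : ℝ => -Real.log 4 - Real.log r) (𝓝[>] 0) atTop :=
            tendsto_atTop_add_const_left _ _
              (tendsto_neg_atBot_atTop.comp Real.tendsto_log_nhdsGT_zero)
          refine h2.congr' ?_
          filter_upwards [self_mem_nhdsWithin] with r hr using (hcl r hr).symm
        have h3 := (tendsto_rpow_neg_atTop hexp).comp h1
        -- The default values of division, logarithm and power at r = 0 agree with the limit, so the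
        -- antiderivative is continuous up to 0.
        have h4 : Real.log (1 / (4 * 0)) ^ (-(1 / s - 1)) = 0 := by
          rw [mul_zero, div_zero, Real.log_zero, Real.zero_rpow (by linarith)]
        rw [ContinuousWithinAt, h4]
        exact h3
      · have hM := one_le_log_inv h0 hr.2
        refine ContinuousAt.continuousWithinAt ?_
        refine ContinuousAt.rpow_const (ContinuousAt.log ?_ (by positivity)) (Or.inl (by linarith))
        exact continuousAt_const.div (continuousAt_const.mul continuousAt_id) (by positivity)
    · intro r hr
      have hM := one_le_log_inv hr.1 hr.2.le
      have := hr.1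
      unfold pinchBound
      positivity
  refine (hint.const_mul (1 / s - 1)⁻¹).congr (ae_of_all _ fun r => ?_)
  simp only
  rw [← mul_assoc, inv_mul_cancel₀ hexp.ne', one_mul]

lemma ne_zero_of_mem_pinchedDomain {s : ℝ} {z w : ℂ} (h : (z, w) ∈ pinchedDomain s) : z ≠ 0 := by
  rintro rfl
  rw [mem_pinchedDomain_iff] at h
  have := profile_nonneg s ((‖w‖ ^ 2 - 3) * (‖w‖ ^ 2 - 5))
  norm_num at h; linarith

lemma lintegral_enorm_inv_sq_lt_top {s : ℝ} (hs : s ∈ Ioo (0 : ℝ) 1) :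
    ∫⁻ z in Metric.ball (0 : ℂ) (1 / 16),
      ENNReal.ofReal (‖z‖⁻¹ ^ 2 * (60 * pinchBound s ‖z‖)) < ⊤ := by
  have hm : Measurable fun z : ℂ => ENNReal.ofReal (‖z‖⁻¹ ^ 2 * (60 * pinchBound s ‖z‖)) := by
    unfold pinchBound; fun_prop
  rw [← lintegral_indicator measurableSet_ball,
    lintegral_eq_lintegral_circleMap 0 (hm.indicator measurableSet_ball)]
  have hint := ((integrableOn_pinchBound_div hs).const_mul (120 * Real.pi)).lintegral_lt_top
  refine lt_of_le_of_lt ?_ hint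
  rw [← lintegral_indicator measurableSet_Ioi, ← lintegral_indicator measurableSet_Ioc]
  refine lintegral_mono fun r => ?_
  by_cases hr : r ∈ Ioi (0 : ℝ)
  · rw [indicator_of_mem hr]
    have hr0 : 0 < r := hr
    have hn : ∀ θ, ‖circleMap 0 r θ‖ = r := fun θ => by simp [circleMap, abs_of_pos hr0]
    by_cases hr1 : r < 1 / 16
    · have hmem : ∀ θ, circleMap 0 r θ ∈ Metric.ball (0 : ℂ) (1 / 16) := fun θ => by
        rw [mem_ball_zero_iff, hn]; exact hr1
      simp only [indicator_of_mem (hmem _), hn]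
      rw [indicator_of_mem (show r ∈ Ioc 0 (1 / 16) from ⟨hr0, hr1.le⟩), setLIntegral_const,
        Real.volume_Ioo, ← ENNReal.ofReal_mul' (by have := Real.pi_pos; linarith),
        ← ENNReal.ofReal_mul hr0.le]
      refine le_of_eq (congrArg _ ?_)
      field_simp; ring
    · have hmem : ∀ θ, circleMap 0 r θ ∉ Metric.ball (0 : ℂ) (1 / 16) := fun θ => by
        rw [mem_ball_zero_iff, hn]; exact hr1
      simp only [indicator_of_notMem (hmem _)]
      simp
  · rw [indicator_of_notMem hr]; exact zero_le

/-- The domain avoids z = 0. For |z| < 1/16 the w-integration gives the fibre area; elsewhere 1/z is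
bounded and the domain has finite volume. -/
lemma inv_fst_mem_bergmanSpace {s : ℝ} (hs : s ∈ Ioo (0 : ℝ) 1) :
    (fun p : ℂ × ℂ => p.1⁻¹) ∈ bergmanSpace (pinchedDomain s) := by
  have hΩ := isOpen_pinchedDomain hs.1
  refine ⟨fun p hp => ?_, (by fun_prop : Measurable fun p : ℂ × ℂ => p.1⁻¹).aestronglyMeasurable,
    ?_⟩
  · exact (differentiableAt_fst.inv (ne_zero_of_mem_pinchedDomain hp)).differentiableWithinAt
  rw [eLpNorm_lt_top_iff_lintegral_rpow_enorm_lt_top (by norm_num) (by norm_num)]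
  have hB : MeasurableSet {p : ℂ × ℂ | p.1 ∈ Metric.ball (0 : ℂ) (1 / 16)} :=
    measurable_fst measurableSet_ball
  have hG : ∀ p : ℂ × ℂ, ‖p.1⁻¹‖ₑ ^ (2 : ℝ≥0∞).toReal = ENNReal.ofReal (‖p.1‖⁻¹ ^ 2) := by
    intro p
    rw [ENNReal.toReal_ofNat, ENNReal.rpow_ofNat, ← ofReal_norm, ← ENNReal.ofReal_pow
      (norm_nonneg _), norm_inv]
  simp_rw [hG]
  rw [← lintegral_inter_add_sdiff _ _ hB, ENNReal.add_lt_top]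
  constructor
  · refine lt_of_le_of_lt ?_ (lintegral_enorm_inv_sq_lt_top hs)
    have hmΩ : Measurable ((pinchedDomain s ∩ {p | p.1 ∈ Metric.ball (0 : ℂ) (1 / 16)}).indicator
        fun p : ℂ × ℂ => ENNReal.ofReal (‖p.1‖⁻¹ ^ 2)) :=
      Measurable.indicator (by fun_prop) (hΩ.measurableSet.inter hB)
    rw [← lintegral_indicator (hΩ.measurableSet.inter hB), Measure.volume_eq_prod,
      lintegral_prod _ hmΩ.aemeasurable, ← lintegral_indicator measurableSet_ball]
    refine lintegral_mono fun z => ?_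
    by_cases hz : z ∈ Metric.ball (0 : ℂ) (1 / 16)
    · rw [indicator_of_mem hz]
      have hS : MeasurableSet {w : ℂ | (z, w) ∈ pinchedDomain s} :=
        (hΩ.preimage (by fun_prop : Continuous fun w : ℂ => (z, w))).measurableSet
      have hle : ∀ w, (pinchedDomain s ∩ {p | p.1 ∈ Metric.ball (0 : ℂ) (1 / 16)}).indicator
          (fun p : ℂ × ℂ => ENNReal.ofReal (‖p.1‖⁻¹ ^ 2)) (z, w) ≤
          {w : ℂ | (z, w) ∈ pinchedDomain s}.indicator
            (fun _ => ENNReal.ofReal (‖z‖⁻¹ ^ 2)) w := by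
        intro w
        by_cases hw : (z, w) ∈ pinchedDomain s
        · rw [indicator_of_mem (show w ∈ {w : ℂ | (z, w) ∈ pinchedDomain s} from hw)]
          exact indicator_le_self _ _ _
        · rw [indicator_of_notMem fun h => hw h.1]; exact zero_le
      refine (lintegral_mono hle).trans ?_
      rw [lintegral_indicator hS, setLIntegral_const, ENNReal.ofReal_mul (by positivity)]
      gcongr
      rcases eq_or_ne z 0 with h0 | h0
      · have : {w : ℂ | (z, w) ∈ pinchedDomain s} = ∅ := by
          ext w
          simp only [mem_ofPred_eq, mem_empty_iff_false, iff_false]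
          exact fun h => ne_zero_of_mem_pinchedDomain h h0
        rw [this, measure_empty]; exact zero_le
      · exact volume_fiber_le hs.1 h0 (mem_ball_zero_iff.1 hz).le
    · have : ∀ w, (pinchedDomain s ∩ {p | p.1 ∈ Metric.ball (0 : ℂ) (1 / 16)}).indicator
          (fun p : ℂ × ℂ => ENNReal.ofReal (‖p.1‖⁻¹ ^ 2)) (z, w) = 0 := fun w =>
        indicator_of_notMem (fun h => hz h.2) _
      rw [lintegral_congr this, lintegral_zero]; exact zero_le
  · have hmeas : MeasurableSet
        (pinchedDomain s \ {p : ℂ × ℂ | p.1 ∈ Metric.ball (0 : ℂ) (1 / 16)}) :=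
      hΩ.measurableSet.diff hB
    refine lt_of_le_of_lt (setLIntegral_mono' hmeas (g := fun _ => ENNReal.ofReal 256)
      fun p hp => ?_) ?_
    · have h16 : 1 / 16 ≤ ‖p.1‖ := by
        have h := hp.2
        rw [mem_ofPred_eq, mem_ball_zero_iff, not_lt] at h
        exact h
      refine ENNReal.ofReal_le_ofReal ?_
      have : ‖p.1‖⁻¹ ≤ 16 := by
        rw [inv_le_comm₀ (by linarith) (by norm_num)]; linarith
      calc ‖p.1‖⁻¹ ^ 2 ≤ 16 ^ 2 := by gcongr
        _ = 256 := by norm_num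
    · rw [setLIntegral_const]
      refine ENNReal.mul_lt_top ENNReal.ofReal_lt_top ?_
      exact (measure_mono sdiff_subset).trans_lt (isBounded_pinchedDomain hs.1).measure_lt_top

/-! ### Conclusion. -/

lemma not_isDenseInBergmanSpace_bergmanLogSpace {s q : ℝ} (hs : s ∈ Ioo (0 : ℝ) 1)
    (hq : 1 / s - 1 ≤ q) :
    ¬ IsDenseInBergmanSpace (bergmanLogSpace q (pinchedDomain s)) (pinchedDomain s) := by
  intro hdense
  obtain ⟨C, hC, hbound⟩ := exists_enorm_fiberResidue_le hs.1
  have hf := inv_fst_mem_bergmanSpace hs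
  -- At this distance the bound on the residue of 1/z - g is C/(C + 1) < 1, whereas that residue is
  -- 1.
  obtain ⟨g, hg, hlt⟩ := hdense _ hf (1 / (C.toReal + 1)) (by positivity)
  have hneg : DifferentiableOn ℂ ((-1 : ℂ) • g) (pinchedDomain s) := hg.1.const_smul _
  have hres : fiberResidue ((fun p : ℂ × ℂ => p.1⁻¹) + (-1 : ℂ) • g) = 1 := by
    rw [fiberResidue_add hs.1 hf.1 hneg, fiberResidue_smul, fiberResidue_eq_zero hs hq hg,
      fiberResidue_inv_fst]
    simp
  have h1 := hbound _ (hf.1.add hneg)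
  rw [hres, show (fun p : ℂ × ℂ => p.1⁻¹) + (-1 : ℂ) • g = (fun p : ℂ × ℂ => p.1⁻¹) - g by
    rw [neg_one_smul, sub_eq_add_neg]] at h1
  have h2 : C * eLpNorm ((fun p : ℂ × ℂ => p.1⁻¹) - g) 2 (volume.restrict (pinchedDomain s)) ≤
      ENNReal.ofReal (C.toReal * (1 / (C.toReal + 1))) := by
    rw [ENNReal.ofReal_mul ENNReal.toReal_nonneg, ENNReal.ofReal_toReal hC]
    gcongr
  have h3 := h1.trans h2
  rw [enorm_one, ENNReal.one_le_ofReal, mul_one_div,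
    le_div_iff₀ (by positivity)] at h3
  linarith

theorem theorem1p5 (s : ℝ) (hs : s ∈ Set.Ioo (0 : ℝ) 1) :
    ∃ Ω : Set (ℂ × ℂ), IsSmoothBoundedDomain Ω ∧ ¬ IsPseudoconvex Ω ∧
      ∀ q : ℝ, 1 / s - 1 ≤ q →
        ¬ IsDenseInBergmanSpace (bergmanLogSpace q Ω) Ω ∧
        ∃ w ∈ Ω, (fun z => bergmanKernel Ω z w) ∉ bergmanLogSpace q Ω := by
  refine ⟨pinchedDomain s, isSmoothBoundedDomain_pinchedDomain hs.1,
    not_isPseudoconvex_pinchedDomain hs.1, fun q hq =>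
    ⟨not_isDenseInBergmanSpace_bergmanLogSpace hs hq, ?_⟩⟩
  obtain ⟨C, hC, hbound⟩ := exists_enorm_fiberResidue_le hs.1
  obtain ⟨w, hw, hne⟩ := exists_bergmanKernel_ne_zero (isOpen_pinchedDomain hs.1) fiberResidue
    (fun f hf g hg => fiberResidue_add hs.1 hf.1 hg.1) (fun c f _ => fiberResidue_smul c f) hC
    (fun f hf => hbound f hf.1) (inv_fst_mem_bergmanSpace hs)
    (by rw [fiberResidue_inv_fst]; exact one_ne_zero)
  exact ⟨w, hw, fun hlog => hne (fiberResidue_eq_zero hs hq hlog)⟩
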